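/- Let $\varphi:(0,\infty)\to(0,\infty)$ satisfy: (i) $\varphi\in C^1((0,\infty))$; (ii) $(s\varphi(s))'>0$ for all $s>0$; (iii) the range of $s\mapsto s\varphi(s)$ is $(0,\infty)$; (iv) there are $s_0>0$, $C_1,C_2>0$ and $r>-1$ with $C_1s^r\le (s\varphi(s))'\le C_2s^r$ for $s\in(0,s_0)$, and, if $r=0$, moreover $\lim_{s\to0^+}\varphi(s)$ exists, is finite and positive, and $\lim_{s\to0^+}s\varphi'(s)=0$; (v) there is $s_1>s_0$ such that either $\varphi'(s)\ge0$ for all $s\ge s_1$ or $\varphi'(s)\le0$ for all $s\ge s_1$; (vi) the function $s\mapsto|s\varphi'(s)/\varphi(s)|$ is non-decreasing on $(0,\infty)$. Let $\Lambda:(0,\infty)\to\mathbb R$ be the function defined by $\Lambda\big(s\sqrt{\varphi(s)}\big)=-\dfrac{s\varphi'(s)}{s\varphi'(s)+2\varphi(s)}$ for $s>0$, and let $\Lambda_\infty=\lim_{t\to\infty}\Lambda(t)$ (under (i)–(vi) $\Lambda$ is well defined and the limit exists). Let $\Omega\subset\mathbb R^n$ be a domain (a non-empty connected open set) and, for $h=1,\dots,n$,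 let $\mathscr A^h$ be an $m\times m$ matrix with complex entries in $L^1_{\rm loc}(\Omega)$. Write $\langle a,b\rangle=\sum_j a_j\overline{b_j}$ on $\mathbb C^m$, and let $[C_0^1(\Omega)]^m$ be the space of $\mathbb C^m$-valued $C^1$ functions with compact support in $\Omega$. The operator $Au=\sum_{h=1}^n\partial_h(\mathscr A^h(x)\partial_hu)$ is called $L^\Phi$-dissipative if $$\Re\int_\Omega\sum_{h=1}^n\langle\mathscr A^h\partial_hu,\partial_h(\varphi(|u|)u)\rangle\,dx\ge0$$ for every $u\in[C_0^1(\Omega)]^m$ such that $\varphi(|u|)u\in[C_0^1(\Omega)]^m$ (with $\varphi(|u|)u:=0$ where $u=0$). Theorem. The operator $A$ is $L^\Phi$-dissipative if and only if for each $h=1,\dots,n$, for almost every $x\in\Omega$ and for all $\lambda,\omega\in\mathbb C^m$ with $|\omega|=1$, $$\Re\langle\mathscr A^h(x)\lambda,\lambda\rangle-\Lambda_\infty^2\,\Re\langle\mathscr A^h(x)\omega,\omega\rangle(\Re\langle\lambda,\omega\rangle)^2+\Lambda_\infty\,\Re\big(\langle\mathscr A^h(x)\omega,\lambda\rangle-\langle\mathscr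 A^h(x)\lambda,\omega\rangle\big)\Re\langle\lambda,\omega\rangle\ge0.$$ -/

import Mathlib

open MeasureTheory Filter Topology Set

noncomputable section

/-- The standing conditions on the positive function `φ : (0,∞) → (0,∞)`; values of `φ` outside
`(0,∞)` play no role. -/
structure AdmissiblePhi (φ : ℝ → ℝ) : Prop where
  pos : ∀ s, 0 < s → 0 < φ s
  contDiffOn : ContDiffOn ℝ 1 φ (Ioi 0)
  deriv_pos : ∀ s, 0 < s → 0 < deriv (fun σ => σ * φ σ) s
  range_eq : (fun s => s * φ s) '' Ioi 0 = Ioi 0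
  behaviour : ∃ s₀ : ℝ, 0 < s₀ ∧
    (∃ C₁ C₂ r : ℝ, 0 < C₁ ∧ 0 < C₂ ∧ -1 < r ∧
      (∀ s ∈ Ioo 0 s₀, C₁ * s ^ r ≤ deriv (fun σ => σ * φ σ) s ∧
        deriv (fun σ => σ * φ σ) s ≤ C₂ * s ^ r) ∧
      (r = 0 → (∃ φ₀ : ℝ, 0 < φ₀ ∧ Tendsto φ (𝓝[>] 0) (𝓝 φ₀)) ∧
        Tendsto (fun s => s * deriv φ s) (𝓝[>] 0) (𝓝 0))) ∧
    (∃ s₁ : ℝ, s₀ < s₁ ∧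
      ((∀ s, s₁ ≤ s → 0 ≤ deriv φ s) ∨ (∀ s, s₁ ≤ s → deriv φ s ≤ 0)))
  mono : MonotoneOn (fun s => |s * deriv φ s / φ s|) (Ioi 0)

/-- The function `s ↦ - s φ'(s) / (s φ'(s) + 2 φ(s))`. -/
def lambdaOfS (φ : ℝ → ℝ) (s : ℝ) : ℝ :=
  -(s * deriv φ s / (s * deriv φ s + 2 * φ s))

/-- The function `Λ` on `(0,∞)`, given by `Λ (s √(φ s)) = - s φ'(s) / (s φ'(s) + 2 φ(s))`
(see `Lambda_apply`). -/
def Lambda (φ : ℝ → ℝ) (t : ℝ) : ℝ :=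
  lambdaOfS φ (Function.invFunOn (fun s => s * √(φ s)) (Ioi 0) t)

/-- `Λ_∞ = lim_{t → ∞} Λ(t)`; the limit exists, see `tendsto_Lambda`. -/
def LambdaInfty (φ : ℝ → ℝ) : ℝ := limUnder atTop (Lambda φ)

namespace AdmissiblePhi

variable {φ : ℝ → ℝ}

theorem strictMonoOn_mul (hφ : AdmissiblePhi φ) :
    StrictMonoOn (fun s => s * φ s) (Ioi 0) := by
  refine strictMonoOn_of_deriv_pos (convex_Ioi 0)
    (continuousOn_id.mul hφ.contDiffOn.continuousOn) ?_
  intro s hs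
  rw [interior_Ioi] at hs
  exact hφ.deriv_pos s hs

theorem mul_sqrt_eq {s : ℝ} (hs : 0 < s) :
    s * √(φ s) = √(s * (s * φ s)) := by
  rw [← mul_assoc, Real.sqrt_mul (by positivity), Real.sqrt_mul_self hs.le]

theorem strictMonoOn (hφ : AdmissiblePhi φ) :
    StrictMonoOn (fun s => s * √(φ s)) (Ioi 0) := by
  intro a ha b hb hab
  have ha' : (0 : ℝ) < a := ha
  have hb' : (0 : ℝ) < b := hb
  have h := hφ.strictMonoOn_mul ha hb hab
  simp only at h ⊢
  rw [mul_sqrt_eq ha, mul_sqrt_eq hb]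
  have := hφ.pos a ha
  exact Real.sqrt_lt_sqrt (by positivity) (by gcongr)

theorem exists_eq (hφ : AdmissiblePhi φ) {t : ℝ} (ht : 0 < t) :
    ∃ s ∈ Ioi (0 : ℝ), s * √(φ s) = t := by
  have : t ^ 2 ∈ (fun s => s * φ s) '' Ioi 0 := by
    rw [hφ.range_eq]
    exact pow_pos ht 2
  obtain ⟨b, hb, hbt⟩ := this
  have hb' : (0 : ℝ) < b := hb
  simp only at hbt
  have hmin : (0 : ℝ) < min b 1 := lt_min hb' one_pos
  have hmax : (0 : ℝ) < max b 1 := lt_max_of_lt_left hb'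
  have hcont : ContinuousOn (fun s => s * √(φ s)) (Icc (min b 1) (max b 1)) :=
    (continuousOn_id.mul hφ.contDiffOn.continuousOn.sqrt).mono
      (fun x hx => hmin.trans_le hx.1)
  have hle : min b 1 ≤ max b 1 := min_le_max
  have h1 : min b 1 * φ (min b 1) ≤ t ^ 2 := by
    rw [← hbt]
    exact hφ.strictMonoOn_mul.monotoneOn (mem_Ioi.2 hmin) hb (min_le_left _ _)
  have h2 : t ^ 2 ≤ max b 1 * φ (max b 1) := by
    rw [← hbt]
    exact hφ.strictMonoOn_mul.monotoneOn hb (mem_Ioi.2 hmax) (le_max_left _ _)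
  have hp1 := hφ.pos _ hmin
  have hmem : t ∈ Icc ((fun s => s * √(φ s)) (min b 1)) ((fun s => s * √(φ s)) (max b 1)) := by
    constructor
    · simp only
      rw [mul_sqrt_eq hmin]
      refine Real.sqrt_le_iff.2 ⟨ht.le, ?_⟩
      have := mul_le_of_le_one_left (b := min b 1 * φ (min b 1)) (by positivity)
        (min_le_right b 1)
      linarith
    · simp only
      rw [mul_sqrt_eq hmax]
      refine Real.le_sqrt_of_sq_le ?_
      have := le_mul_of_one_le_left (b := max b 1 * φ (max b 1)) (by nlinarith [sq_nonneg t])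
        (le_max_right b 1)
      linarith
  obtain ⟨s, hs, hst⟩ := intermediate_value_Icc hle hcont hmem
  exact ⟨s, hmin.trans_le hs.1, hst⟩

/-- The defining relation of `Λ`. -/
theorem Lambda_apply (hφ : AdmissiblePhi φ) {s : ℝ} (hs : 0 < s) :
    Lambda φ (s * √(φ s)) = -(s * deriv φ s / (s * deriv φ s + 2 * φ s)) := by
  have h : Function.invFunOn (fun s => s * √(φ s)) (Ioi 0) (s * √(φ s)) = s :=
    hφ.strictMonoOn.injOn.leftInvOn_invFunOn (mem_Ioi.2 hs)
  rw [Lambda, h, lambdaOfS]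

theorem lambdaOfS_eq (hφ : AdmissiblePhi φ) {s : ℝ} (hs : 0 < s) :
    -1 < s * deriv φ s / φ s ∧
      lambdaOfS φ s = -(s * deriv φ s / φ s) / (s * deriv φ s / φ s + 2) := by
  have hp := hφ.pos s hs
  have hd : DifferentiableAt ℝ φ s :=
    (hφ.contDiffOn.differentiableOn one_ne_zero).differentiableAt (Ioi_mem_nhds hs)
  have hD : deriv (fun σ => σ * φ σ) s = φ s + s * deriv φ s := by
    have := ((hasDerivAt_id s).mul hd.hasDerivAt).deriv
    simpa [Pi.mul_def] using this
  have h1 : 0 < φ s + s * deriv φ s := hD ▸ hφ.deriv_pos s hs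
  refine ⟨by rw [lt_div_iff₀ hp]; linarith, ?_⟩
  rw [lambdaOfS]
  have : s * deriv φ s + 2 * φ s ≠ 0 := by linarith
  field_simp

/-- The limit defining `Λ_∞` exists. -/
theorem tendsto_Lambda (hφ : AdmissiblePhi φ) :
    Tendsto (Lambda φ) atTop (𝓝 (LambdaInfty φ)) := by
  suffices ∃ l, Tendsto (Lambda φ) atTop (𝓝 l) by
    obtain ⟨l, hl⟩ := this
    rw [LambdaInfty, hl.limUnder_eq]
    exact hl
  obtain ⟨s₀, hs₀, -, s₁, hs₁, hsgn⟩ := hφ.behaviour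
  have hs1 : 0 < s₁ := hs₀.trans hs₁
  set T := s₁ * √(φ s₁) with hT
  have hTpos : 0 < T := mul_pos hs1 (Real.sqrt_pos.2 (hφ.pos s₁ hs1))
  have key : ∀ t, T ≤ t → ∃ s, s₁ ≤ s ∧ s * √(φ s) = t ∧ Lambda φ t = lambdaOfS φ s := by
    intro t ht
    obtain ⟨s, hs, rfl⟩ := hφ.exists_eq (hTpos.trans_le ht)
    exact ⟨s, (hφ.strictMonoOn.le_iff_le (mem_Ioi.2 hs1) hs).1 ht, rfl, hφ.Lambda_apply hs⟩
  have hev : (fun t => Lambda φ (max t T)) =ᶠ[atTop] Lambda φ := by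
    filter_upwards [eventually_ge_atTop T] with t ht
    rw [max_eq_left ht]
  rcases hsgn with hsgn | hsgn
  · have hanti : Antitone (fun t => Lambda φ (max t T)) := by
      intro t t' htt'
      obtain ⟨s, hs, hst, hL⟩ := key (max t T) (le_max_right _ _)
      obtain ⟨s', hs', hst', hL'⟩ := key (max t' T) (le_max_right _ _)
      have p : 0 < s := hs1.trans_le hs
      have p' : 0 < s' := hs1.trans_le hs'
      have hss : s ≤ s' := by
        refine (hφ.strictMonoOn.le_iff_le (mem_Ioi.2 p) (mem_Ioi.2 p')).1 ?_
        rw [hst, hst']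
        exact max_le_max_right _ htt'
      have hg := hφ.mono (mem_Ioi.2 p) (mem_Ioi.2 p') hss
      simp only at hg ⊢
      rw [hL, hL', (hφ.lambdaOfS_eq p).2, (hφ.lambdaOfS_eq p').2]
      have q : 0 ≤ s * deriv φ s / φ s :=
        div_nonneg (mul_nonneg p.le (hsgn s hs)) (hφ.pos s p).le
      have q' : 0 ≤ s' * deriv φ s' / φ s' :=
        div_nonneg (mul_nonneg p'.le (hsgn s' hs')) (hφ.pos s' p').le
      rw [abs_of_nonneg q, abs_of_nonneg q'] at hg
      rw [div_le_div_iff₀ (by linarith) (by linarith)]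
      nlinarith
    refine ⟨_, (tendsto_atTop_ciInf hanti ⟨-1, ?_⟩).congr' hev⟩
    rintro _ ⟨t, rfl⟩
    obtain ⟨s, hs, hst, hL⟩ := key (max t T) (le_max_right _ _)
    have p : 0 < s := hs1.trans_le hs
    have := (hφ.lambdaOfS_eq p).1
    simp only
    rw [hL, (hφ.lambdaOfS_eq p).2, le_div_iff₀ (by linarith)]
    linarith
  · have hmono : Monotone (fun t => Lambda φ (max t T)) := by
      intro t t' htt'
      obtain ⟨s, hs, hst, hL⟩ := key (max t T) (le_max_right _ _)
      obtain ⟨s', hs', hst', hL'⟩ := key (max t' T) (le_max_right _ _)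
      have p : 0 < s := hs1.trans_le hs
      have p' : 0 < s' := hs1.trans_le hs'
      have hss : s ≤ s' := by
        refine (hφ.strictMonoOn.le_iff_le (mem_Ioi.2 p) (mem_Ioi.2 p')).1 ?_
        rw [hst, hst']
        exact max_le_max_right _ htt'
      have hg := hφ.mono (mem_Ioi.2 p) (mem_Ioi.2 p') hss
      simp only at hg ⊢
      rw [hL, hL', (hφ.lambdaOfS_eq p).2, (hφ.lambdaOfS_eq p').2]
      have q : s * deriv φ s / φ s ≤ 0 :=
        div_nonpos_of_nonpos_of_nonneg
          (mul_nonpos_of_nonneg_of_nonpos p.le (hsgn s hs)) (hφ.pos s p).le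
      have q' : s' * deriv φ s' / φ s' ≤ 0 :=
        div_nonpos_of_nonpos_of_nonneg
          (mul_nonpos_of_nonneg_of_nonpos p'.le (hsgn s' hs')) (hφ.pos s' p').le
      rw [abs_of_nonpos q, abs_of_nonpos q'] at hg
      have l := (hφ.lambdaOfS_eq p).1
      have l' := (hφ.lambdaOfS_eq p').1
      rw [div_le_div_iff₀ (by linarith) (by linarith)]
      nlinarith
    refine ⟨_, (tendsto_atTop_ciSup hmono ⟨1, ?_⟩).congr' hev⟩
    rintro _ ⟨t, rfl⟩
    obtain ⟨s, hs, hst, hL⟩ := key (max t T) (le_max_right _ _)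
    have p : 0 < s := hs1.trans_le hs
    have := (hφ.lambdaOfS_eq p).1
    simp only
    rw [hL, (hφ.lambdaOfS_eq p).2, div_le_iff₀ (by linarith)]
    linarith

end AdmissiblePhi

/-- Membership in `[C₀¹(Ω)]ᵐ`: continuously differentiable with compact support contained
in `Ω`. -/
structure IsC1Compact {n m : ℕ} (Ω : Set (EuclideanSpace ℝ (Fin n)))
    (u : EuclideanSpace ℝ (Fin n) → EuclideanSpace ℂ (Fin m)) : Prop where
  contDiff : ContDiff ℝ 1 u
  hasCompactSupport : HasCompactSupport u
  tsupport_subset : tsupport u ⊆ Ω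

/-- The partial derivative `∂ₕ u`. -/
def partialDeriv {n m : ℕ} (h : Fin n)
    (u : EuclideanSpace ℝ (Fin n) → EuclideanSpace ℂ (Fin m))
    (x : EuclideanSpace ℝ (Fin n)) : EuclideanSpace ℂ (Fin m) :=
  fderiv ℝ u x (EuclideanSpace.single h 1)

/-- The Hermitian product `⟨a, b⟩ = ∑ⱼ aⱼ conj(bⱼ)` of `ℂᵐ`, linear in the first argument
(Mathlib's `inner` is linear in the second one). -/
def hermProd {m : ℕ} (a b : EuclideanSpace ℂ (Fin m)) : ℂ := inner ℂ b a

/-- The product of the matrix `M` and the vector `a`. -/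
def matVec {m : ℕ} (M : Matrix (Fin m) (Fin m) ℂ) (a : EuclideanSpace ℂ (Fin m)) :
    EuclideanSpace ℂ (Fin m) :=
  WithLp.toLp 2 (M.mulVec a.ofLp)

/-- `L^Φ`-dissipativity of the system `∂ₕ (𝒜ʰᵏ ∂ₖ)` in `Ω`. -/
def IsLPhiDissipative {n m : ℕ} (φ : ℝ → ℝ) (Ω : Set (EuclideanSpace ℝ (Fin n)))
    (𝒜 : Fin n → Fin n → EuclideanSpace ℝ (Fin n) → Matrix (Fin m) (Fin m) ℂ) : Prop :=
  ∀ u : EuclideanSpace ℝ (Fin n) → EuclideanSpace ℂ (Fin m),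
    IsC1Compact Ω u → IsC1Compact Ω (fun x => φ ‖u x‖ • u x) →
      0 ≤ (∫ x in Ω, ∑ h, ∑ k, hermProd (matVec (𝒜 h k x) (partialDeriv k u x))
        (partialDeriv h (fun y => φ ‖u y‖ • u y) x)).re

/-- The coefficients of `∂ₕ (𝒜ʰ ∂ₕ)` as a special case of those of `∂ₕ (𝒜ʰᵏ ∂ₖ)`. -/
def diagCoeff {n m : ℕ}
    (𝒜 : Fin n → EuclideanSpace ℝ (Fin n) → Matrix (Fin m) (Fin m) ℂ) :
    Fin n → Fin n → EuclideanSpace ℝ (Fin n) → Matrix (Fin m) (Fin m) ℂ :=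
  fun h k x => if h = k then 𝒜 h x else 0

end

/-! Write f(z) = φ(|z|)z. Where u ≠ 0 the integrand is the sum over h of Re⟨𝒜ʰη, Df(u)η⟩ with η =
∂ₕu, so everything rests on the sign of this quadratic form in η.

For |w| = 1 and k = sφ'(s)/φ(s), Df(sw)η = φ(s)(η + k Re⟨η,w⟩w). An invertible linear substitution
turns non-negativity of the form at all sw into the criterion with Λ_∞ replaced by -k/(k+2)
(`algCond_iff`). The criterion survives multiplication of its parameter by θ ∈ [0,1]
(`AlgCond.mul`). Conditions (v) and (vi) make every value of Λ such a multiple of Λ_∞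
(`exists_lambdaOfS_eq_mul`), and the criterion is closed under limits. Hence the criterion at Λ_∞
amounts to non-negativity of the form for all z ≠ 0 (`algCond_LambdaInfty_iff`).

Sufficiency is then pointwise; at a zero of u with ∂ₕu ≠ 0, ∂ₕ(f∘u) is a non-negative multiple of
∂ₕu (`exists_partialDeriv_phiMap_of_eq_zero`).

For necessity, take an admissible field equal to z near the support of a cutoff ψ and add to it η
times a small, rapidly oscillating function of x_h. In the limit only the h-th form, weighted by ψ²,
is added to the base energy (`nonneg_base_add_integral`). Scaling η makes the base energy negligible
(`integral_sq_mul_nonneg`). Localization and a countable dense set of pairs (z, η) give the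
criterion almost everywhere (`ae_algCond`). -/

/-- The map `z ↦ φ(|z|) z` of `ℂᵐ`. -/
noncomputable def phiMap {m : ℕ} (φ : ℝ → ℝ) (z : EuclideanSpace ℂ (Fin m)) :
    EuclideanSpace ℂ (Fin m) := φ ‖z‖ • z

/-- The real bilinear form `Re ⟨M a, b⟩`. -/
noncomputable def reForm {m : ℕ} (M : Matrix (Fin m) (Fin m) ℂ)
    (a b : EuclideanSpace ℂ (Fin m)) : ℝ := (hermProd (matVec M a) b).re

/-! ### Real-linear algebra of the form Re⟨Ma, b⟩. -/

section algebra

variable {m : ℕ} (M : Matrix (Fin m) (Fin m) ℂ) (a b c : EuclideanSpace ℂ (Fin m)) (t : ℝ)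

theorem reForm_eq_sum :
    reForm M a b = (∑ i, ∑ j, M i j * (a j * starRingEnd ℂ (b i))).re := by
  simp only [reForm, hermProd, matVec, PiLp.inner_apply, RCLike.inner_apply, Matrix.mulVec,
    dotProduct, Finset.sum_mul, mul_assoc]

theorem reForm_add_left : reForm M (a + b) c = reForm M a c + reForm M b c := by
  simp [reForm_eq_sum, add_mul, mul_add, Finset.sum_add_distrib]

theorem reForm_add_right : reForm M a (b + c) = reForm M a b + reForm M a c := by
  simp [reForm_eq_sum, mul_add, Finset.sum_add_distrib]

theorem hermProd_re_smul_left : (hermProd (t • a) b).re = t * (hermProd a b).re := by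
  simp [hermProd, inner_smul_right_eq_smul]

theorem hermProd_re_smul_right : (hermProd a (t • b)).re = t * (hermProd a b).re := by
  simp [hermProd, inner_smul_left_eq_smul]

theorem hermProd_re_add_left :
    (hermProd (a + b) c).re = (hermProd a c).re + (hermProd b c).re := by
  simp [hermProd]

theorem matVec_smul : matVec M (t • a) = t • matVec M a := by
  ext i; simp [matVec, Matrix.mulVec_smul]

theorem reForm_smul_left : reForm M (t • a) b = t * reForm M a b := by
  rw [reForm, matVec_smul, hermProd_re_smul_left, reForm]

theorem reForm_smul_right : reForm M a (t • b) = t * reForm M a b :=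
  hermProd_re_smul_right _ _ _

theorem hermProd_self_re : (hermProd a a).re = ‖a‖ ^ 2 := by
  simpa [hermProd] using inner_self_eq_norm_sq (𝕜 := ℂ) a

theorem continuous_reForm {X : Type*} [TopologicalSpace X] {f g : X → EuclideanSpace ℂ (Fin m)}
    (hf : Continuous f) (hg : Continuous g) : Continuous fun x => reForm M (f x) (g x) := by
  simp only [reForm_eq_sum]
  fun_prop

end algebra

/-! ### The differential of z ↦ φ(|z|)z and the algebraic criterion. -/

theorem contDiffAt_phiMap {m : ℕ} {φ : ℝ → ℝ} (hφ : AdmissiblePhi φ)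
    {z : EuclideanSpace ℂ (Fin m)} (hz : z ≠ 0) : ContDiffAt ℝ 1 (phiMap φ) z := by
  have h1 : ContDiffAt ℝ 1 (fun y : EuclideanSpace ℂ (Fin m) => ‖y‖) z := contDiffAt_norm ℂ hz
  have h2 : ContDiffAt ℝ 1 φ ‖z‖ := hφ.contDiffOn.contDiffAt (Ioi_mem_nhds (norm_pos_iff.2 hz))
  exact (h2.comp z h1).smul contDiffAt_id

/-- The derivative is taken along the line sw + tη. The squared norm is a quadratic polynomial in t,
which gives Re⟨η,w⟩ as the derivative of the norm at t = 0. -/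
theorem fderiv_phiMap_apply {m : ℕ} {φ : ℝ → ℝ} (hφ : AdmissiblePhi φ) {s : ℝ} (hs : 0 < s)
    {w : EuclideanSpace ℂ (Fin m)} (hw : ‖w‖ = 1) (η : EuclideanSpace ℂ (Fin m)) :
    fderiv ℝ (phiMap φ) (s • w) η =
      φ s • (η + (s * deriv φ s / φ s * (hermProd η w).re) • w) := by
  have hns : ‖s • w‖ = s := by rw [norm_smul, hw, mul_one, Real.norm_of_nonneg hs.le]
  have hz : s • w ≠ 0 := by rw [← norm_pos_iff, hns]; exact hs
  have hd : DifferentiableAt ℝ (phiMap φ) (s • w) :=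
    (contDiffAt_phiMap hφ hz).differentiableAt one_ne_zero
  have hline : HasDerivAt (fun t : ℝ => s • w + t • η) η 0 := by
    simpa using ((hasDerivAt_id (0 : ℝ)).smul_const η).const_add (s • w)
  have hline0 : s • w + (0 : ℝ) • η = s • w := by simp
  have hsq : HasDerivAt (fun t : ℝ => ‖s • w + t • η‖ ^ 2)
      (2 * s * (hermProd η w).re) 0 := by
    have heq : (fun t : ℝ => ‖s • w + t • η‖ ^ 2) =
        fun t => s ^ 2 + t * (2 * s * (hermProd η w).re) + t ^ 2 * ‖η‖ ^ 2 := by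
      funext t
      have := norm_add_sq (𝕜 := ℂ) (s • w) (t • η)
      rw [this, hns, norm_smul, mul_pow, Real.norm_eq_abs, sq_abs]
      have : RCLike.re (inner ℂ (s • w) (t • η)) = s * (t * (hermProd η w).re) := by
        change (hermProd (t • η) (s • w)).re = _
        rw [hermProd_re_smul_right, hermProd_re_smul_left]
      rw [this]; ring
    rw [heq]
    have h1 := (((hasDerivAt_id (0 : ℝ)).mul_const (2 * s * (hermProd η w).re)).const_add
      (s ^ 2)).add (((hasDerivAt_id (0 : ℝ)).pow 2).mul_const (‖η‖ ^ 2))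
    refine h1.congr_deriv ?_
    simp
  have hnorm : HasDerivAt (fun t : ℝ => ‖s • w + t • η‖) (hermProd η w).re 0 := by
    have h1 := hsq.sqrt (by rw [hline0, hns]; positivity)
    simp only [Real.sqrt_sq (norm_nonneg _), hline0, hns, Real.sqrt_sq hs.le] at h1
    convert h1 using 1
    field_simp
  have hφd : HasDerivAt φ (deriv φ s) ‖s • w + (0 : ℝ) • η‖ := by
    rw [hline0, hns]
    exact ((hφ.contDiffOn.differentiableOn one_ne_zero).differentiableAt
      (Ioi_mem_nhds hs)).hasDerivAt
  have hcomp := (hφd.comp (0 : ℝ) hnorm).smul hline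
  have hD : HasDerivAt (fun t : ℝ => phiMap φ (s • w + t • η))
      (fderiv ℝ (phiMap φ) (s • w) η) 0 := by
    have h := hd.hasFDerivAt
    rw [← hline0] at h
    have := h.comp_hasDerivAt (0 : ℝ) hline
    rwa [hline0] at this
  have huniq := hD.unique hcomp
  rw [huniq]
  simp only [Function.comp, hline0, hns]
  rw [smul_add, smul_smul, smul_smul]
  congr 2
  have := (hφ.pos s hs).ne'
  field_simp

/-- The algebraic criterion with parameter `L`. -/
def AlgCond {m : ℕ} (M : Matrix (Fin m) (Fin m) ℂ) (L : ℝ) : Prop :=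
  ∀ l w : EuclideanSpace ℂ (Fin m), ‖w‖ = 1 →
    0 ≤ reForm M l l - L ^ 2 * reForm M w w * (hermProd l w).re ^ 2
      + L * (reForm M w l - reForm M l w) * (hermProd l w).re

/-- Put L = -k/(k+2), p = Re⟨l,w⟩ and η = l + Lpw. Then η + k Re⟨η,w⟩w = l - Lpw, and expanding
Re⟨M(l + Lpw), l - Lpw⟩ gives exactly the criterion. -/
theorem algCond_iff {m : ℕ} {M : Matrix (Fin m) (Fin m) ℂ} {φ : ℝ → ℝ} (hφ : AdmissiblePhi φ)
    {s : ℝ} (hs : 0 < s) :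
    AlgCond M (lambdaOfS φ s) ↔ ∀ w η : EuclideanSpace ℂ (Fin m), ‖w‖ = 1 →
      0 ≤ reForm M η (fderiv ℝ (phiMap φ) (s • w) η) := by
  obtain ⟨hk, hL⟩ := hφ.lambdaOfS_eq hs
  have hp := hφ.pos s hs
  set k := s * deriv φ s / φ s with hkdef
  have hform : ∀ w η : EuclideanSpace ℂ (Fin m), ‖w‖ = 1 →
      reForm M η (fderiv ℝ (phiMap φ) (s • w) η) =
        φ s * (reForm M η η + k * (hermProd η w).re * reForm M η w) := by
    intro w η hw
    rw [fderiv_phiMap_apply hφ hs hw, reForm_smul_right, reForm_add_right, reForm_smul_right]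
  have key : ∀ l w : EuclideanSpace ℂ (Fin m), ‖w‖ = 1 → ∀ η,
      η = l + (lambdaOfS φ s * (hermProd l w).re) • w →
      reForm M l l - lambdaOfS φ s ^ 2 * reForm M w w * (hermProd l w).re ^ 2
        + lambdaOfS φ s * (reForm M w l - reForm M l w) * (hermProd l w).re =
      reForm M η η + k * (hermProd η w).re * reForm M η w := by
    intro l w hw η hη
    subst hη
    rw [hL]
    simp only [reForm_add_left, reForm_add_right, reForm_smul_left, reForm_smul_right,
      hermProd_re_add_left, hermProd_re_smul_left, hermProd_self_re, hw]
    have : k + 2 ≠ 0 := by linarith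
    field_simp
    ring
  constructor
  · intro h w η hw
    rw [hform w η hw]
    refine mul_nonneg hp.le ?_
    -- The inverse substitution: 1 + L = 2/(k+2), so the component along w is multiplied by 1 + k/2.
    have hη : η = (η + (k / 2 * (hermProd η w).re) • w) + (lambdaOfS φ s *
        (hermProd (η + (k / 2 * (hermProd η w).re) • w) w).re) • w := by
      rw [add_assoc, ← add_smul, hL, hermProd_re_add_left, hermProd_re_smul_left,
        hermProd_self_re, hw]
      have h0 : k / 2 * (hermProd η w).re + -k / (k + 2) * ((hermProd η w).re
          + k / 2 * (hermProd η w).re * 1 ^ 2) = 0 := by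
        have : k + 2 ≠ 0 := by linarith
        field_simp
        ring
      rw [h0, zero_smul, add_zero]
    have := key _ w hw η hη
    rw [← this]
    exact h _ w hw
  · intro h l w hw
    rw [key l w hw _ rfl]
    have := h w (l + (lambdaOfS φ s * (hermProd l w).re) • w) hw
    rw [hform _ _ hw] at this
    exact nonneg_of_mul_nonneg_right this hp

/-- The choice w = il/|l| gives Re⟨l,w⟩ = 0, which leaves only the first term of the criterion. -/
theorem AlgCond.reForm_self_nonneg {m : ℕ} {M : Matrix (Fin m) (Fin m) ℂ} {L : ℝ}
    (h : AlgCond M L) (l : EuclideanSpace ℂ (Fin m)) : 0 ≤ reForm M l l := by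
  rcases eq_or_ne l 0 with rfl | hl
  · simp [reForm_eq_sum]
  have hn : ‖l‖ ≠ 0 := norm_ne_zero_iff.2 hl
  have hw : ‖(Complex.I * (‖l‖⁻¹ : ℝ)) • l‖ = 1 := by
    rw [norm_smul, norm_mul, Complex.norm_I, Complex.norm_real, norm_inv, norm_norm, one_mul,
      inv_mul_cancel₀ hn]
  have h0 : (hermProd l ((Complex.I * (‖l‖⁻¹ : ℝ)) • l)).re = 0 := by
    rw [hermProd, inner_smul_left, inner_self_eq_norm_sq_to_K]
    simp [← Complex.ofReal_pow]
  have := h l _ hw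
  rw [h0] at this
  simpa using this

/-- With p = Re⟨l,w⟩, the expression at θL is θ times the one at L, plus (1-θ)Re⟨Ml,l⟩, plus
θ(1-θ)L²p² Re⟨Mw,w⟩; all three are non-negative. -/
theorem AlgCond.mul {m : ℕ} {M : Matrix (Fin m) (Fin m) ℂ} {L θ : ℝ}
    (h : AlgCond M L) (h0 : 0 ≤ θ) (h1 : θ ≤ 1) : AlgCond M (θ * L) := by
  intro l w hw
  have ha := h.reForm_self_nonneg l
  have hb := h.reForm_self_nonneg w
  have hq := h l w hw
  have e1 := mul_nonneg h0 hq
  have e2 := mul_nonneg (sub_nonneg.2 h1) ha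
  have e3 := mul_nonneg (mul_nonneg (mul_nonneg h0 (sub_nonneg.2 h1)) hb)
    (sq_nonneg (L * (hermProd l w).re))
  linarith

/-! ### Constant sign of sφ'/φ and comparison of Λ with its limit. -/

namespace AdmissiblePhi

variable {φ : ℝ → ℝ}

theorem continuousOn_deriv (hφ : AdmissiblePhi φ) : ContinuousOn (deriv φ) (Ioi 0) :=
  hφ.contDiffOn.continuousOn_deriv_of_isOpen isOpen_Ioi le_rfl

/-- The intermediate value theorem gives a zero of sφ'/φ in [a, b]; since |sφ'/φ| is non-decreasing,
it already vanishes at a. -/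
theorem exists_index_eq_zero (hφ : AdmissiblePhi φ) {a b : ℝ} (ha : 0 < a) (hab : a ≤ b)
    (h : (0 : ℝ) ∈ uIcc (a * deriv φ a / φ a) (b * deriv φ b / φ b)) :
    a * deriv φ a / φ a = 0 := by
  have hcont : ContinuousOn (fun s => s * deriv φ s / φ s) (uIcc a b) := by
    rw [uIcc_of_le hab]
    refine (ContinuousOn.div (continuousOn_id.mul hφ.continuousOn_deriv)
      hφ.contDiffOn.continuousOn fun s hs => (hφ.pos s hs).ne').mono
      fun s hs => ha.trans_le hs.1
  obtain ⟨c, hc, hc0⟩ := intermediate_value_uIcc hcont h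
  rw [uIcc_of_le hab] at hc
  have := hφ.mono (mem_Ioi.2 ha) (mem_Ioi.2 (ha.trans_le hc.1)) hc.1
  simp only at this hc0
  rw [hc0, abs_zero] at this
  exact abs_eq_zero.1 (le_antisymm this (abs_nonneg _))

theorem index_sign (hφ : AdmissiblePhi φ) :
    (∀ s, 0 < s → 0 ≤ s * deriv φ s / φ s) ∨ (∀ s, 0 < s → s * deriv φ s / φ s ≤ 0) := by
  obtain ⟨s₀, hs₀, -, s₁, hs₁, hsgn⟩ := hφ.behaviour
  have hs1 : 0 < s₁ := hs₀.trans hs₁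
  rcases hsgn with hsgn | hsgn
  · have hpos : ∀ s, s₁ ≤ s → 0 ≤ s * deriv φ s / φ s := fun s hs =>
      div_nonneg (mul_nonneg (hs1.trans_le hs).le (hsgn s hs)) (hφ.pos s (hs1.trans_le hs)).le
    refine Or.inl fun s hs => ?_
    by_contra! hneg
    have h1 := hpos (max s s₁) (le_max_right _ _)
    exact hneg.ne (hφ.exists_index_eq_zero hs (le_max_left _ _)
      (by rw [uIcc_of_le (hneg.le.trans h1)]; exact ⟨hneg.le, h1⟩))
  · have hneg : ∀ s, s₁ ≤ s → s * deriv φ s / φ s ≤ 0 := fun s hs =>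
      div_nonpos_of_nonpos_of_nonneg (mul_nonpos_of_nonneg_of_nonpos (hs1.trans_le hs).le
        (hsgn s hs)) (hφ.pos s (hs1.trans_le hs)).le
    refine Or.inr fun s hs => ?_
    by_contra! hpos
    have h1 := hneg (max s s₁) (le_max_right _ _)
    exact hpos.ne' (hφ.exists_index_eq_zero hs (le_max_left _ _)
      (by rw [uIcc_of_ge (h1.trans hpos.le)]; exact ⟨h1, hpos.le⟩))

theorem Lambda_eq_lambdaOfS (hφ : AdmissiblePhi φ) {t : ℝ} (ht : 0 < t) :
    ∃ s, 0 < s ∧ s * √(φ s) = t ∧ Lambda φ t = lambdaOfS φ s := by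
  obtain ⟨s, hs, rfl⟩ := hφ.exists_eq ht
  exact ⟨s, hs, rfl, hφ.Lambda_apply hs⟩

/-- As sφ'/φ keeps one sign and grows in absolute value, and k ↦ -k/(k+2) is decreasing on k > -1,
`lambdaOfS φ` moves monotonically away from 0. Every value thus lies between 0 and Λ_∞. -/
theorem exists_lambdaOfS_eq_mul (hφ : AdmissiblePhi φ) {s : ℝ} (hs : 0 < s) :
    ∃ θ : ℝ, 0 ≤ θ ∧ θ ≤ 1 ∧ lambdaOfS φ s = θ * LambdaInfty φ := by
  have hlim := hφ.tendsto_Lambda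
  have hev : ∀ P : ℝ → Prop, (∀ s', s ≤ s' → P (lambdaOfS φ s')) →
      ∀ᶠ t in atTop, P (Lambda φ t) := by
    intro P hP
    have hpos : 0 < s * √(φ s) := mul_pos hs (Real.sqrt_pos.2 (hφ.pos s hs))
    filter_upwards [eventually_ge_atTop (s * √(φ s))] with t ht
    obtain ⟨s', hs', rfl, h⟩ := hφ.Lambda_eq_lambdaOfS (hpos.trans_le ht)
    rw [h]
    exact hP s' ((hφ.strictMonoOn.le_iff_le (mem_Ioi.2 hs) (mem_Ioi.2 hs')).1 ht)
  obtain ⟨k1, e1⟩ := hφ.lambdaOfS_eq hs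
  rcases hφ.index_sign with h | h
  · have hle : LambdaInfty φ ≤ lambdaOfS φ s := by
      refine le_of_tendsto hlim (hev (· ≤ lambdaOfS φ s) fun s' hs' => ?_)
      have hp' := hs.trans_le hs'
      have hm := hφ.mono (mem_Ioi.2 hs) (mem_Ioi.2 hp') hs'
      simp only [abs_of_nonneg (h s hs), abs_of_nonneg (h s' hp')] at hm
      obtain ⟨k2, e2⟩ := hφ.lambdaOfS_eq hp'
      rw [e1, e2, div_le_div_iff₀ (by linarith) (by linarith)]
      linarith
    have h0 : lambdaOfS φ s ≤ 0 := by
      rw [e1]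
      exact div_nonpos_of_nonpos_of_nonneg (neg_nonpos.2 (h s hs)) (by linarith)
    rcases eq_or_lt_of_le (hle.trans h0) with hz | hz
    · exact ⟨0, le_rfl, zero_le_one, by rw [zero_mul]; exact le_antisymm h0 (hz ▸ hle)⟩
    · exact ⟨lambdaOfS φ s / LambdaInfty φ, div_nonneg_of_nonpos h0 hz.le,
        (div_le_one_of_neg hz).2 hle, (div_mul_cancel₀ _ hz.ne).symm⟩
  · have hle : lambdaOfS φ s ≤ LambdaInfty φ := by
      refine ge_of_tendsto hlim (hev (lambdaOfS φ s ≤ ·) fun s' hs' => ?_)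
      have hp' := hs.trans_le hs'
      have hm := hφ.mono (mem_Ioi.2 hs) (mem_Ioi.2 hp') hs'
      simp only [abs_of_nonpos (h s hs), abs_of_nonpos (h s' hp')] at hm
      obtain ⟨k2, e2⟩ := hφ.lambdaOfS_eq hp'
      rw [e1, e2, div_le_div_iff₀ (by linarith) (by linarith)]
      linarith
    have h0 : 0 ≤ lambdaOfS φ s := by
      rw [e1]
      exact div_nonneg (neg_nonneg.2 (h s hs)) (by linarith)
    rcases eq_or_lt_of_le (h0.trans hle) with hz | hz
    · exact ⟨0, le_rfl, zero_le_one, by rw [zero_mul]; exact le_antisymm (hz ▸ hle) h0⟩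
    · exact ⟨lambdaOfS φ s / LambdaInfty φ, div_nonneg h0 hz.le,
        (div_le_one₀ hz).2 hle, (div_mul_cancel₀ _ hz.ne').symm⟩

end AdmissiblePhi

/-- The algebraic criterion with `L = Λ_∞` says that the derivative of `z ↦ φ(|z|) z` keeps the
form `Re ⟨M ·, ·⟩` non-negative. -/
theorem algCond_LambdaInfty_iff {m : ℕ} {M : Matrix (Fin m) (Fin m) ℂ} {φ : ℝ → ℝ}
    (hφ : AdmissiblePhi φ) :
    AlgCond M (LambdaInfty φ) ↔ ∀ z η : EuclideanSpace ℂ (Fin m), z ≠ 0 →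
      0 ≤ reForm M η (fderiv ℝ (phiMap φ) z η) := by
  constructor
  · intro h z η hz
    have hs := norm_pos_iff.2 hz
    obtain ⟨θ, h0, h1, hθ⟩ := hφ.exists_lambdaOfS_eq_mul hs
    have h2 := (algCond_iff hφ hs).1 (hθ ▸ h.mul h0 h1) (‖z‖⁻¹ • z) η
      (by rw [norm_smul, norm_inv, norm_norm, inv_mul_cancel₀ hs.ne'])
    rwa [smul_smul, mul_inv_cancel₀ hs.ne', one_smul] at h2
  -- The criterion holds at each Λ(t) and is a closed condition on the parameter, so t → ∞ is
  -- allowed.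
  · intro h l w hw
    have hev : ∀ᶠ t in atTop, 0 ≤ reForm M l l
        - Lambda φ t ^ 2 * reForm M w w * (hermProd l w).re ^ 2
        + Lambda φ t * (reForm M w l - reForm M l w) * (hermProd l w).re := by
      filter_upwards [eventually_gt_atTop 0] with t ht
      obtain ⟨s, hs, -, hL⟩ := hφ.Lambda_eq_lambdaOfS ht
      rw [hL]
      refine (algCond_iff hφ hs).2 (fun w η hw => h _ η ?_) l w hw
      rw [← norm_pos_iff, norm_smul, hw, mul_one, Real.norm_of_nonneg hs.le]
      exact hs
    have hlim := hφ.tendsto_Lambda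
    refine ge_of_tendsto ?_ hev
    exact ((tendsto_const_nhds.sub (((hlim.pow 2).mul_const _).mul_const _))).add
      ((hlim.mul_const _).mul_const _)

/-! ### Fields that vanish smoothly enough: gluing at the origin. -/

theorem continuous_ite_pos {G : ℝ → ℝ} (hG : ContinuousOn G (Ioi 0))
    (h0 : Tendsto G (𝓝[>] 0) (𝓝 0)) : Continuous fun s => if 0 < s then G s else 0 := by
  rw [continuous_iff_continuousAt]
  intro s
  rcases lt_trichotomy s 0 with hs | rfl | hs
  · have hc : ContinuousAt (fun _ : ℝ => (0 : ℝ)) s := continuousAt_const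
    refine hc.congr ?_
    filter_upwards [Iio_mem_nhds hs] with t ht
    rw [if_neg (not_lt.2 (mem_Iio.1 ht).le)]
  · rw [ContinuousAt, if_neg (lt_irrefl _)]
    refine Tendsto.mono_left (Tendsto.sup (y := 𝓝 0) (x₁ := 𝓝[≤] 0) (x₂ := 𝓝[>] 0) ?_ ?_)
      (nhdsLE_sup_nhdsGT (0 : ℝ)).ge
    · refine tendsto_const_nhds.congr' ?_
      filter_upwards [self_mem_nhdsWithin] with t ht
      rw [if_neg (not_lt.2 ht)]
    · refine h0.congr' ?_
      filter_upwards [self_mem_nhdsWithin] with t ht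
      rw [if_pos (mem_Ioi.1 ht)]
  · refine (hG.continuousAt (Ioi_mem_nhds hs)).congr ?_
    filter_upwards [Ioi_mem_nhds hs] with t ht
    rw [if_pos (mem_Ioi.1 ht)]

/-- Only the limits of G and G' at 0⁺ are needed: a continuous function whose derivative extends
continuously across a point is differentiable there. -/
theorem contDiff_ite_pos {G G' : ℝ → ℝ} (hG : ∀ s, 0 < s → HasDerivAt G (G' s) s)
    (hG' : ContinuousOn G' (Ioi 0)) (h0 : Tendsto G (𝓝[>] 0) (𝓝 0))
    (h0' : Tendsto G' (𝓝[>] 0) (𝓝 0)) : ContDiff ℝ 1 fun s => if 0 < s then G s else 0 := by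
  have hc := continuous_ite_pos (fun s hs => (hG s hs).continuousAt.continuousWithinAt) h0
  have hc' := continuous_ite_pos hG' h0'
  have hne : ∀ s ≠ (0 : ℝ), HasDerivAt (fun s => if 0 < s then G s else 0)
      (if 0 < s then G' s else 0) s := by
    intro s hs
    rcases lt_or_gt_of_ne hs with hs | hs
    · rw [if_neg hs.le.not_gt]
      refine (hasDerivAt_const s (0 : ℝ)).congr_of_eventuallyEq ?_
      filter_upwards [Iio_mem_nhds hs] with t ht
      rw [if_neg (not_lt.2 (mem_Iio.1 ht).le)]
    · rw [if_pos hs]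
      refine (hG s hs).congr_of_eventuallyEq ?_
      filter_upwards [Ioi_mem_nhds hs] with t ht
      rw [if_pos (mem_Ioi.1 ht)]
  have hall : ∀ s, HasDerivAt (fun s => if 0 < s then G s else 0)
      (if 0 < s then G' s else 0) s :=
    hasDerivAt_of_hasDerivAt_of_ne' hne hc.continuousAt hc'.continuousAt
  rw [contDiff_one_iff_deriv]
  refine ⟨fun s => (hall s).differentiableAt, ?_⟩
  rwa [show deriv (fun s => if 0 < s then G s else 0) = _ from funext fun s => (hall s).deriv]

namespace AdmissiblePhi

variable {φ : ℝ → ℝ}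

theorem tendsto_mul_zero (hφ : AdmissiblePhi φ) :
    Tendsto (fun s => s * φ s) (𝓝[>] 0) (𝓝 0) := by
  rw [tendsto_order]
  constructor
  · intro a ha
    filter_upwards [self_mem_nhdsWithin] with s hs
    exact ha.trans (mul_pos hs (hφ.pos s hs))
  · intro a ha
    have : a ∈ (fun s => s * φ s) '' Ioi 0 := by rw [hφ.range_eq]; exact ha
    obtain ⟨b, hb, rfl⟩ := this
    filter_upwards [Ioo_mem_nhdsGT hb] with s hs
    exact hφ.strictMonoOn_mul (mem_Ioi.2 hs.1) hb hs.2

theorem contDiffOn_mul (hφ : AdmissiblePhi φ) : ContDiffOn ℝ 1 (fun s => s * φ s) (Ioi 0) :=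
  contDiffOn_id.mul hφ.contDiffOn

/-- For r < 0 the derivative of sφ(s) blows up at 0. Composition with Rs^N changes the bound on the
derivative to a multiple of s^(Nr+N-1), which tends to 0 once N(r+1) > 1. -/
theorem exists_pow_contDiff (hφ : AdmissiblePhi φ) {R : ℝ} (hR : 0 < R) :
    ∃ N : ℕ, N ≠ 0 ∧
      ContDiff ℝ 1 fun s => if 0 < s then R * s ^ N * φ (R * s ^ N) else 0 := by
  obtain ⟨s₀, hs₀, ⟨C₁, C₂, r, hC₁, hC₂, hr, hbd, -⟩, -⟩ := hφ.behaviour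
  obtain ⟨N, hN⟩ := exists_nat_gt (1 / (r + 1))
  have hr1 : 0 < r + 1 := by linarith
  have hN1 : 1 < N * (r + 1) := by rwa [div_lt_iff₀ hr1] at hN
  have hN0 : N ≠ 0 := by rintro rfl; norm_num at hN1
  refine ⟨N, hN0, ?_⟩
  set f : ℝ → ℝ := fun s => s * φ s with hf
  have hcd := hφ.contDiffOn_mul
  have hmap : ∀ s : ℝ, 0 < s → 0 < R * s ^ N := fun s hs => by positivity
  have hlim : Tendsto (fun s : ℝ => R * s ^ N) (𝓝[>] 0) (𝓝[>] 0) := by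
    refine tendsto_nhdsWithin_iff.2 ⟨?_, ?_⟩
    · have : Continuous fun s : ℝ => R * s ^ N := by fun_prop
      have := this.tendsto 0
      rw [zero_pow hN0, mul_zero] at this
      exact this.mono_left nhdsWithin_le_nhds
    · filter_upwards [self_mem_nhdsWithin] with s hs
      exact hmap s hs
  refine contDiff_ite_pos (G := fun s => f (R * s ^ N))
    (G' := fun s => deriv f (R * s ^ N) * (R * (N * s ^ (N - 1)))) ?_ ?_ ?_ ?_
  · intro s hs
    have h1 : HasDerivAt f (deriv f (R * s ^ N)) (R * s ^ N) :=
      ((hcd.differentiableOn one_ne_zero).differentiableAt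
        (Ioi_mem_nhds (hmap s hs))).hasDerivAt
    exact h1.comp s ((hasDerivAt_pow N s).const_mul R)
  · have h1 : ContinuousOn (deriv f) (Ioi 0) :=
      hcd.continuousOn_deriv_of_isOpen isOpen_Ioi le_rfl
    refine (h1.comp (f := fun s : ℝ => R * s ^ N) (by fun_prop) fun s hs => hmap s hs).mul
      (by fun_prop)
  · exact hφ.tendsto_mul_zero.comp hlim
  · have hexp : 0 < (N : ℝ) * r + (N - 1 : ℕ) := by
      rw [Nat.cast_sub (Nat.one_le_iff_ne_zero.2 hN0)]
      push_cast
      linarith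
    have hz : Tendsto (fun s : ℝ => C₂ * R ^ r * R * N * s ^ ((N : ℝ) * r + (N - 1 : ℕ)))
        (𝓝[>] 0) (𝓝 0) := by
      have h1 := (Real.continuousAt_rpow_const 0 _ (Or.inr hexp.le)).tendsto
      rw [Real.zero_rpow hexp.ne'] at h1
      have := (h1.const_mul (C₂ * R ^ r * R * N)).mono_left (nhdsWithin_le_nhds (s := Ioi 0))
      rwa [mul_zero] at this
    refine tendsto_of_tendsto_of_tendsto_of_le_of_le' tendsto_const_nhds hz ?_ ?_
    · filter_upwards [self_mem_nhdsWithin] with s hs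
      have hs' : (0 : ℝ) < s := hs
      have := hφ.deriv_pos _ (hmap s hs)
      positivity
    · filter_upwards [self_mem_nhdsWithin, hlim (Ioo_mem_nhdsGT hs₀)] with s hs hs2
      have hs' : (0 : ℝ) < s := hs
      have h1 := (hbd _ hs2).2
      calc deriv f (R * s ^ N) * (R * (N * s ^ (N - 1)))
          ≤ C₂ * (R * s ^ N) ^ r * (R * (N * s ^ (N - 1))) := by gcongr
        _ = _ := by
          rw [Real.mul_rpow hR.le (by positivity), Real.rpow_add hs', Real.rpow_natCast,
            ← Real.rpow_natCast s N, ← Real.rpow_mul hs'.le]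
          ring

end AdmissiblePhi

/-- A vector field in `[C₀¹(Ω)]ᵐ`, constant near a given compact set, whose image under
`z ↦ φ(|z|) z` is again in `[C₀¹(Ω)]ᵐ`. -/
theorem exists_base {n m : ℕ} {φ : ℝ → ℝ} (hφ : AdmissiblePhi φ)
    {Ω K : Set (EuclideanSpace ℝ (Fin n))} (hΩ : IsOpen Ω) (hK : IsCompact K) (hKΩ : K ⊆ Ω)
    {z : EuclideanSpace ℂ (Fin m)} (hz : z ≠ 0) :
    ∃ u : EuclideanSpace ℝ (Fin n) → EuclideanSpace ℂ (Fin m), IsC1Compact Ω u ∧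
      IsC1Compact Ω (fun x => phiMap φ (u x)) ∧ ∀ᶠ x in 𝓝ˢ K, u x = z := by
  have hR := norm_pos_iff.2 hz
  obtain ⟨N, hN0, hN⟩ := hφ.exists_pow_contDiff hR
  obtain ⟨L, hL, hKL, hLΩ⟩ := exists_compact_between hK hΩ hKΩ
  obtain ⟨τ, hτ1, hτ0, hτ⟩ := exists_contMDiffMap_one_nhds_of_subset_interior
    (n := 1) (modelWithCornersSelf ℝ (EuclideanSpace ℝ (Fin n))) hK.isClosed hKL
  have hτc : ContDiff ℝ 1 τ := τ.contMDiff.contDiff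
  have hu : ∀ v : EuclideanSpace ℝ (Fin n) → EuclideanSpace ℂ (Fin m), ContDiff ℝ 1 v →
      (∀ x, τ x = 0 → v x = 0) → IsC1Compact Ω v := by
    intro v hv hv0
    have hsub : tsupport v ⊆ L := by
      refine closure_minimal (fun x hx => ?_) hL.isClosed
      by_contra hxL
      exact hx (hv0 x (hτ0 x hxL))
    exact ⟨hv, hL.of_isClosed_subset (isClosed_tsupport v) hsub, hsub.trans hLΩ⟩
  -- The power N flattens the cutoff τ where it reaches 0, so that the image of the field is also
  -- C¹.
  refine ⟨fun x => (τ x ^ N) • z, hu _ ((hτc.pow N).smul contDiff_const) fun x hx => ?_,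
    hu _ ?_ fun x hx => ?_, ?_⟩
  · rw [hx, zero_pow hN0, zero_smul]
  · have heq : (fun x => phiMap φ ((τ x ^ N) • z)) = fun x =>
        (if 0 < τ x then ‖z‖ * τ x ^ N * φ (‖z‖ * τ x ^ N) else 0) • (‖z‖⁻¹ • z) := by
      funext x
      have h0 := (hτ x).1
      rcases h0.eq_or_lt with h | h
      · rw [← h, zero_pow hN0, if_neg (lt_irrefl _), zero_smul, zero_smul, phiMap, smul_zero]
      · rw [if_pos h, phiMap, norm_smul, Real.norm_of_nonneg (by positivity), smul_smul,
          smul_smul, mul_comm (τ x ^ N) ‖z‖]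
        congr 1
        field_simp
    rw [heq]
    exact (hN.comp hτc).smul contDiff_const
  · simp only [hx, zero_pow hN0, zero_smul, phiMap, smul_zero]
  · filter_upwards [hτ1] with x hx
    rw [hx, one_pow, one_smul]

/-! ### Pointwise sign of the integrand, including the zeros of u. -/

section pointwise

variable {n m : ℕ} {φ : ℝ → ℝ} {u : EuclideanSpace ℝ (Fin n) → EuclideanSpace ℂ (Fin m)}
  {x : EuclideanSpace ℝ (Fin n)}

theorem partialDeriv_phiMap (hφ : AdmissiblePhi φ) (hu : DifferentiableAt ℝ u x)
    (hx : u x ≠ 0) (h : Fin n) :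
    partialDeriv h (fun y => phiMap φ (u y)) x =
      fderiv ℝ (phiMap φ) (u x) (partialDeriv h u x) := by
  have h1 := ((contDiffAt_phiMap hφ hx).differentiableAt one_ne_zero).hasFDerivAt.comp x
    hu.hasFDerivAt
  change fderiv ℝ (phiMap φ ∘ u) x _ = _
  rw [h1.fderiv]
  rfl

theorem tendsto_slope_partialDeriv (hu : DifferentiableAt ℝ u x) (hx : u x = 0) (h : Fin n) :
    Tendsto (fun t : ℝ => t⁻¹ • u (x + t • EuclideanSpace.single h 1)) (𝓝[≠] 0)
      (𝓝 (partialDeriv h u x)) := by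
  have h1 := hu.hasFDerivAt.hasLineDerivAt (EuclideanSpace.single h (1 : ℝ))
  have h2 := h1.tendsto_slope_zero
  simpa [hx, partialDeriv] using h2

/-- The difference quotients of φ(|u|)u are φ(|u|) times those of u. Projecting both on ∂ₕu ≠ 0
shows that the factor φ(|u|) > 0 converges along the line, whatever φ does near 0; c is its limit.
-/
theorem exists_partialDeriv_phiMap_of_eq_zero (hφ : AdmissiblePhi φ)
    (hu : DifferentiableAt ℝ u x) (hg : DifferentiableAt ℝ (fun y => phiMap φ (u y)) x)
    (hx : u x = 0) {h : Fin n} (hne : partialDeriv h u x ≠ 0) :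
    ∃ c : ℝ, 0 ≤ c ∧ partialDeriv h (fun y => phiMap φ (u y)) x = c • partialDeriv h u x := by
  have hgx : phiMap φ (u x) = 0 := by rw [phiMap, hx, smul_zero]
  have hs1 := tendsto_slope_partialDeriv hu hx h
  have hs2 := tendsto_slope_partialDeriv hg hgx h
  set η := partialDeriv h u x with hη
  set ζ := partialDeriv h (fun y => phiMap φ (u y)) x with hζ
  set v : ℝ → EuclideanSpace ℂ (Fin m) := fun t => u (x + t • EuclideanSpace.single h 1) with hv
  have hcont : Continuous fun a : EuclideanSpace ℂ (Fin m) => (hermProd a η).re := by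
    unfold hermProd; fun_prop
  have hr : Tendsto (fun t : ℝ => (hermProd (t⁻¹ • v t) η).re) (𝓝[≠] 0) (𝓝 (‖η‖ ^ 2)) := by
    rw [← hermProd_self_re]
    exact (hcont.tendsto η).comp hs1
  have hq : Tendsto (fun t : ℝ => (hermProd (t⁻¹ • phiMap φ (v t)) η).re) (𝓝[≠] 0)
      (𝓝 (hermProd ζ η).re) := (hcont.tendsto ζ).comp hs2
  have hne2 : ‖η‖ ^ 2 ≠ 0 := pow_ne_zero 2 (norm_ne_zero_iff.2 hne)
  have hmul : ∀ t : ℝ, t⁻¹ • phiMap φ (v t) = φ ‖v t‖ • (t⁻¹ • v t) := fun t => by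
    rw [phiMap, smul_comm]
  have hev : ∀ᶠ t in 𝓝[≠] (0 : ℝ), (hermProd (t⁻¹ • v t) η).re ≠ 0 :=
    hr.eventually_ne hne2
  have hφlim : Tendsto (fun t : ℝ => φ ‖v t‖) (𝓝[≠] 0) (𝓝 ((hermProd ζ η).re / ‖η‖ ^ 2)) := by
    refine (hq.div hr hne2).congr' ?_
    filter_upwards [hev] with t ht
    rw [Pi.div_apply, hmul, hermProd_re_smul_left, mul_div_cancel_right₀ _ ht]
  refine ⟨(hermProd ζ η).re / ‖η‖ ^ 2, ge_of_tendsto hφlim ?_, ?_⟩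
  · filter_upwards [hev] with t ht
    have : v t ≠ 0 := by
      intro h0
      rw [h0] at ht
      simp [hermProd] at ht
    exact (hφ.pos _ (norm_pos_iff.2 this)).le
  · refine tendsto_nhds_unique hs2 ?_
    refine (hφlim.smul hs1).congr fun t => ?_
    exact (hmul t).symm

theorem AlgCond.reForm_partialDeriv_nonneg (hφ : AdmissiblePhi φ)
    {M : Matrix (Fin m) (Fin m) ℂ} (hM : AlgCond M (LambdaInfty φ))
    (hu : DifferentiableAt ℝ u x) (hg : DifferentiableAt ℝ (fun y => phiMap φ (u y)) x)
    (h : Fin n) :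
    0 ≤ reForm M (partialDeriv h u x) (partialDeriv h (fun y => phiMap φ (u y)) x) := by
  by_cases hx : u x = 0
  · by_cases hη : partialDeriv h u x = 0
    · rw [hη]; simp [reForm_eq_sum]
    · obtain ⟨c, hc, hcη⟩ := exists_partialDeriv_phiMap_of_eq_zero hφ hu hg hx hη
      rw [hcη, reForm_smul_right]
      exact mul_nonneg hc (hM.reForm_self_nonneg _)
  · rw [partialDeriv_phiMap hφ hu hx]
    exact (algCond_LambdaInfty_iff hφ).1 hM _ _ hx

end pointwise

/-! ### Integrability and the real-valued energy. -/

section integrability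

variable {n m : ℕ} {Ω : Set (EuclideanSpace ℝ (Fin n))}

theorem continuous_partialDeriv {u : EuclideanSpace ℝ (Fin n) → EuclideanSpace ℂ (Fin m)}
    (hu : ContDiff ℝ 1 u) (h : Fin n) : Continuous (partialDeriv h u) :=
  (hu.continuous_fderiv one_ne_zero).clm_apply continuous_const

theorem partialDeriv_eq_zero_of_notMem
    {u : EuclideanSpace ℝ (Fin n) → EuclideanSpace ℂ (Fin m)} (h : Fin n)
    {x : EuclideanSpace ℝ (Fin n)} (hx : x ∉ tsupport u) : partialDeriv h u x = 0 := by
  rw [partialDeriv, fderiv_of_notMem_tsupport (𝕜 := ℝ) hx, zero_apply]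

theorem integrableOn_hermProd {A : EuclideanSpace ℝ (Fin n) → Matrix (Fin m) (Fin m) ℂ}
    (hΩ : IsOpen Ω) (hA : ∀ i j, LocallyIntegrableOn (fun x => A x i j) Ω volume)
    {K : Set (EuclideanSpace ℝ (Fin n))} (hK : IsCompact K) (hKΩ : K ⊆ Ω)
    {a b : EuclideanSpace ℝ (Fin n) → EuclideanSpace ℂ (Fin m)} (ha : Continuous a)
    (hb : Continuous b) (ha0 : ∀ x ∉ K, a x = 0) :
    IntegrableOn (fun x => hermProd (matVec (A x) (a x)) (b x)) Ω := by
  have heq : (fun x => hermProd (matVec (A x) (a x)) (b x)) =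
      fun x => ∑ i, ∑ j, A x i j * (a x j * starRingEnd ℂ (b x i)) := by
    funext x
    simp only [hermProd, matVec, PiLp.inner_apply, RCLike.inner_apply, Matrix.mulVec,
      dotProduct, Finset.sum_mul, mul_assoc]
  rw [heq]
  refine IntegrableOn.of_forall_sdiff_eq_zero (s := K) ?_ hΩ.measurableSet ?_
  · refine integrable_finsetSum _ fun i _ => integrable_finsetSum _ fun j _ => ?_
    exact IntegrableOn.mul_continuousOn ((hA i j).integrableOn_compact_subset hKΩ hK)
      (Continuous.continuousOn (by fun_prop)) hK
  · intro x hx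
    simp [ha0 x hx.2]

/-- The energy density `Re ∑ₕ ⟨𝒜ʰ ∂ₕu, ∂ₕ(φ(|u|) u)⟩`. -/
noncomputable def energy (φ : ℝ → ℝ)
    (𝒜 : Fin n → EuclideanSpace ℝ (Fin n) → Matrix (Fin m) (Fin m) ℂ)
    (u : EuclideanSpace ℝ (Fin n) → EuclideanSpace ℂ (Fin m))
    (x : EuclideanSpace ℝ (Fin n)) : ℝ :=
  ∑ h, reForm (𝒜 h x) (partialDeriv h u x) (partialDeriv h (fun y => phiMap φ (u y)) x)

variable {φ : ℝ → ℝ} {𝒜 : Fin n → EuclideanSpace ℝ (Fin n) → Matrix (Fin m) (Fin m) ℂ}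

theorem sum_diagCoeff (a b : Fin n → EuclideanSpace ℂ (Fin m)) (x : EuclideanSpace ℝ (Fin n)) :
    ∑ h, ∑ k, hermProd (matVec (diagCoeff 𝒜 h k x) (a k)) (b h) =
      ∑ h, hermProd (matVec (𝒜 h x) (a h)) (b h) := by
  refine Finset.sum_congr rfl fun h _ => ?_
  rw [Finset.sum_eq_single h]
  · simp [diagCoeff]
  · intro k _ hk
    simp [diagCoeff, hk.symm, matVec, hermProd]
  · simp

theorem integrableOn_sum_hermProd (hΩ : IsOpen Ω)
    (h𝒜 : ∀ h i j, LocallyIntegrableOn (fun x => 𝒜 h x i j) Ω volume)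
    {u : EuclideanSpace ℝ (Fin n) → EuclideanSpace ℂ (Fin m)} (hu : IsC1Compact Ω u)
    (hg : IsC1Compact Ω fun x => phiMap φ (u x)) :
    IntegrableOn (fun x => ∑ h, hermProd (matVec (𝒜 h x) (partialDeriv h u x))
      (partialDeriv h (fun y => phiMap φ (u y)) x)) Ω :=
  integrable_finsetSum _ fun h _ => integrableOn_hermProd hΩ (h𝒜 h) hu.hasCompactSupport
    hu.tsupport_subset (continuous_partialDeriv hu.contDiff h)
    (continuous_partialDeriv hg.contDiff h) fun _ hx => partialDeriv_eq_zero_of_notMem h hx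

theorem integrableOn_energy (hΩ : IsOpen Ω)
    (h𝒜 : ∀ h i j, LocallyIntegrableOn (fun x => 𝒜 h x i j) Ω volume)
    {u : EuclideanSpace ℝ (Fin n) → EuclideanSpace ℂ (Fin m)} (hu : IsC1Compact Ω u)
    (hg : IsC1Compact Ω fun x => phiMap φ (u x)) : IntegrableOn (energy φ 𝒜 u) Ω := by
  have := (integrableOn_sum_hermProd hΩ h𝒜 hu hg).re
  have heq : energy φ 𝒜 u = fun x => RCLike.re (∑ h, hermProd (matVec (𝒜 h x)
      (partialDeriv h u x)) (partialDeriv h (fun y => phiMap φ (u y)) x)) := by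
    funext x
    simp [energy, reForm]
  rwa [heq]

theorem isLPhiDissipative_iff (hΩ : IsOpen Ω)
    (h𝒜 : ∀ h i j, LocallyIntegrableOn (fun x => 𝒜 h x i j) Ω volume) :
    IsLPhiDissipative φ Ω (diagCoeff 𝒜) ↔ ∀ u, IsC1Compact Ω u →
      IsC1Compact Ω (fun x => phiMap φ (u x)) → 0 ≤ ∫ x in Ω, energy φ 𝒜 u x := by
  refine forall_congr' fun u => forall_congr' fun hu => forall_congr' fun hg => ?_
  have h1 := integral_re (integrableOn_sum_hermProd hΩ h𝒜 hu hg)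
  simp only [sum_diagCoeff (fun k => partialDeriv k u _)]
  change 0 ≤ RCLike.re (∫ x in Ω, ∑ h, hermProd (matVec (𝒜 h x) (partialDeriv h u x))
    (partialDeriv h (fun y => phiMap φ (u y)) x)) ↔ _
  rw [← h1]
  simp [energy, reForm]

theorem abs_reForm_le (M : Matrix (Fin m) (Fin m) ℂ) (a b : EuclideanSpace ℂ (Fin m)) :
    |reForm M a b| ≤ (∑ i, ∑ j, ‖M i j‖) * (‖a‖ * ‖b‖) := by
  rw [reForm_eq_sum, Finset.sum_mul]
  refine (Complex.abs_re_le_norm _).trans ((norm_sum_le _ _).trans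
    (Finset.sum_le_sum fun i _ => ?_))
  rw [Finset.sum_mul]
  refine (norm_sum_le _ _).trans (Finset.sum_le_sum fun j _ => ?_)
  rw [norm_mul, norm_mul, RCLike.norm_conj]
  gcongr
  · exact PiLp.norm_apply_le a j
  · exact PiLp.norm_apply_le b i

end integrability

/-! ### Adding a scalar profile times a fixed vector where u is constant. -/

section perturbation

variable {n m : ℕ} {Ω : Set (EuclideanSpace ℝ (Fin n))} {φ : ℝ → ℝ}
  {𝒜 : Fin n → EuclideanSpace ℝ (Fin n) → Matrix (Fin m) (Fin m) ℂ}
  {K : Set (EuclideanSpace ℝ (Fin n))} {z η : EuclideanSpace ℂ (Fin m)}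
  {u : EuclideanSpace ℝ (Fin n) → EuclideanSpace ℂ (Fin m)} {σ : EuclideanSpace ℝ (Fin n) → ℝ}

theorem isC1Compact_add_smul (hK : IsCompact K) (hKΩ : K ⊆ Ω) (hu : IsC1Compact Ω u)
    (hσ : ContDiff ℝ 1 σ) (hσK : tsupport σ ⊆ K) : IsC1Compact Ω fun x => u x + σ x • η := by
  have hsub : tsupport (fun x => u x + σ x • η) ⊆ tsupport u ∪ K := by
    refine closure_minimal (fun x hx => ?_) ((isClosed_tsupport u).union hK.isClosed)
    by_contra hxn
    rw [mem_union, not_or] at hxn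
    refine hx ?_
    simp only
    rw [image_eq_zero_of_notMem_tsupport hxn.1,
      image_eq_zero_of_notMem_tsupport (fun h => hxn.2 (hσK h)), zero_smul, add_zero]
  exact ⟨hu.contDiff.add (hσ.smul contDiff_const),
    (hu.hasCompactSupport.isCompact.union hK).of_isClosed_subset (isClosed_tsupport _) hsub,
    hsub.trans (union_subset hu.tsupport_subset hKΩ)⟩

theorem eventuallyEq_add_smul (hσK : tsupport σ ⊆ K) {x : EuclideanSpace ℝ (Fin n)}
    (hx : x ∉ K) : (fun y => u y + σ y • η) =ᶠ[𝓝 x] u := by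
  filter_upwards [(isClosed_tsupport σ).isOpen_compl.mem_nhds fun h => hx (hσK h)] with y hy
  rw [image_eq_zero_of_notMem_tsupport hy, zero_smul, add_zero]

/-- On K the perturbed field avoids 0, where z ↦ φ(|z|)z is C¹; off K it agrees locally with u. -/
theorem isC1Compact_phiMap_add_smul (hφ : AdmissiblePhi φ) (hK : IsCompact K) (hKΩ : K ⊆ Ω)
    (hu : IsC1Compact Ω u) (hg : IsC1Compact Ω fun x => phiMap φ (u x))
    (huz : ∀ x ∈ K, u x = z) (hσ : ContDiff ℝ 1 σ) (hσK : tsupport σ ⊆ K)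
    (hne : ∀ x, z + σ x • η ≠ 0) :
    IsC1Compact Ω fun x => phiMap φ (u x + σ x • η) := by
  have hv := isC1Compact_add_smul (η := η) hK hKΩ hu hσ hσK
  have hsub : tsupport (fun x => phiMap φ (u x + σ x • η)) ⊆
      tsupport (fun x => u x + σ x • η) := by
    refine closure_mono fun x hx => ?_
    contrapose! hx
    simp only [Function.mem_support, not_not] at hx ⊢
    rw [hx, phiMap, smul_zero]
  refine ⟨?_, hv.hasCompactSupport.isCompact.of_isClosed_subset (isClosed_tsupport _) hsub,
    hsub.trans hv.tsupport_subset⟩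
  rw [contDiff_iff_contDiffAt]
  intro x
  by_cases hx : x ∈ K
  · have : u x + σ x • η ≠ 0 := huz x hx ▸ hne x
    exact ContDiffAt.comp (g := phiMap φ) x (contDiffAt_phiMap hφ this) hv.contDiff.contDiffAt
  · refine hg.contDiff.contDiffAt.congr_of_eventuallyEq ?_
    filter_upwards [eventuallyEq_add_smul (u := u) (η := η) hσK hx] with y hy
    rw [hy]

theorem partialDeriv_congr {v : EuclideanSpace ℝ (Fin n) → EuclideanSpace ℂ (Fin m)}
    {x : EuclideanSpace ℝ (Fin n)} (h : u =ᶠ[𝓝 x] v) (k : Fin n) :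
    partialDeriv k u x = partialDeriv k v x := by
  rw [partialDeriv, h.fderiv_eq, partialDeriv]

/-- There are no cross terms: u is constant near K, so its gradient vanishes wherever σ acts. -/
theorem energy_add_smul (hφ : AdmissiblePhi φ)
    (huz : ∀ᶠ x in 𝓝ˢ K, u x = z) (hσ : ContDiff ℝ 1 σ) (hσK : tsupport σ ⊆ K)
    (hne : ∀ x, z + σ x • η ≠ 0) (x : EuclideanSpace ℝ (Fin n)) :
    energy φ 𝒜 (fun y => u y + σ y • η) x = energy φ 𝒜 u x +
      ∑ k, (fderiv ℝ σ x (EuclideanSpace.single k 1)) ^ 2 *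
        reForm (𝒜 k x) η (fderiv ℝ (phiMap φ) (z + σ x • η) η) := by
  rw [energy, energy, ← Finset.sum_add_distrib]
  refine Finset.sum_congr rfl fun k _ => ?_
  by_cases hx : x ∈ K
  · have hloc : u =ᶠ[𝓝 x] fun _ => z := huz.filter_mono (nhds_le_nhdsSet hx)
    have hux : u x = z := hloc.self_of_nhds
    have hdσ := (hσ.differentiable one_ne_zero x).hasFDerivAt
    have hd : HasFDerivAt (fun y => u y + σ y • η) ((fderiv ℝ σ x).smulRight η) x := by
      have h1 := (hdσ.smul_const η).const_add z
      refine h1.congr_of_eventuallyEq ?_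
      filter_upwards [hloc] with y hy
      rw [hy]
    have hv : partialDeriv k (fun y => u y + σ y • η) x =
        (fderiv ℝ σ x (EuclideanSpace.single k 1)) • η := by
      rw [partialDeriv, hd.fderiv, ContinuousLinearMap.smulRight_apply]
    have h0 : partialDeriv k u x = 0 := by
      rw [partialDeriv_congr hloc, partialDeriv, fderiv_fun_const, Pi.zero_apply,
        zero_apply]
    have hne' : u x + σ x • η ≠ 0 := hux ▸ hne x
    rw [partialDeriv_phiMap hφ hd.differentiableAt hne', hv, h0, map_smul, reForm_smul_left,
      reForm_smul_right, hux]
    have : reForm (𝒜 k x) 0 (partialDeriv k (fun y => phiMap φ (u y)) x) = 0 := by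
      simp [reForm_eq_sum]
    rw [this]
    ring
  · have hloc := eventuallyEq_add_smul (u := u) (η := η) hσK hx
    have h2 : (fun y => phiMap φ (u y + σ y • η)) =ᶠ[𝓝 x] fun y => phiMap φ (u y) := by
      filter_upwards [hloc] with y hy
      rw [hy]
    rw [partialDeriv_congr hloc, partialDeriv_congr h2,
      fderiv_of_notMem_tsupport (𝕜 := ℝ) fun h => hx (hσK h)]
    simp

end perturbation

/-! ### Oscillating profiles and the high-frequency limit. -/

section oscillation

variable {n : ℕ} (ψ : EuclideanSpace ℝ (Fin n) → ℝ) (h : Fin n) (μ θ : ℝ)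

/-- The oscillating function `μ⁻¹ ψ(x) sin(μ xₕ + θ)`. -/
noncomputable def osc (x : EuclideanSpace ℝ (Fin n)) : ℝ := μ⁻¹ * ψ x * Real.sin (μ * x h + θ)

variable {ψ}

theorem contDiff_osc (hψ : ContDiff ℝ 1 ψ) : ContDiff ℝ 1 (osc ψ h μ θ) := by
  have h1 : ContDiff ℝ 1 fun x : EuclideanSpace ℝ (Fin n) => x h := by fun_prop
  exact (contDiff_const.mul hψ).mul (Real.contDiff_sin.comp
    ((contDiff_const.mul h1).add contDiff_const))

theorem tsupport_osc_subset : tsupport (osc ψ h μ θ) ⊆ tsupport ψ := by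
  refine closure_mono fun x hx => ?_
  contrapose! hx
  simp only [Function.mem_support, not_not] at hx ⊢
  rw [osc, hx, mul_zero, zero_mul]

theorem abs_osc_le {B : ℝ} (hB : ∀ x, |ψ x| ≤ B) (hμ : 0 < μ) (x : EuclideanSpace ℝ (Fin n)) :
    |osc ψ h μ θ x| ≤ μ⁻¹ * B := by
  rw [osc, abs_mul, abs_mul, abs_of_pos (inv_pos.2 hμ)]
  have h1 := Real.abs_sin_le_one (μ * x h + θ)
  have h2 := mul_le_mul (hB x) h1 (abs_nonneg _) ((abs_nonneg _).trans (hB x))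
  rw [mul_assoc]
  rw [mul_one] at h2
  gcongr

theorem fderiv_osc (hψ : ContDiff ℝ 1 ψ) (hμ : μ ≠ 0) (k : Fin n)
    (x : EuclideanSpace ℝ (Fin n)) :
    fderiv ℝ (osc ψ h μ θ) x (EuclideanSpace.single k 1) =
      μ⁻¹ * fderiv ℝ ψ x (EuclideanSpace.single k 1) * Real.sin (μ * x h + θ) +
        (if h = k then ψ x else 0) * Real.cos (μ * x h + θ) := by
  have h1 := (hψ.differentiable one_ne_zero x).hasFDerivAt
  have h2 : HasFDerivAt (fun x : EuclideanSpace ℝ (Fin n) => x h)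
      (EuclideanSpace.proj h : EuclideanSpace ℝ (Fin n) →L[ℝ] ℝ) x :=
    (EuclideanSpace.proj h : EuclideanSpace ℝ (Fin n) →L[ℝ] ℝ).hasFDerivAt
  have h3 := (h1.const_mul μ⁻¹).mul ((h2.const_mul μ).add_const θ).sin
  have h4 : fderiv ℝ (osc ψ h μ θ) x = _ := h3.fderiv
  rw [h4]
  have h5 : (EuclideanSpace.proj h : EuclideanSpace ℝ (Fin n) →L[ℝ] ℝ)
      (EuclideanSpace.single k 1) = if h = k then 1 else 0 := PiLp.single_apply 2 ℝ k 1 h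
  simp only [add_apply, smul_apply, smul_eq_mul, h5]
  split_ifs
  · field_simp
    ring
  · ring

/-- Pairing the phases 0 and π/2 cancels the oscillation exactly, so a pointwise limit as μ → ∞
replaces any weak-convergence argument. -/
theorem sq_fderiv_osc_add (hψ : ContDiff ℝ 1 ψ) (hμ : μ ≠ 0) (k : Fin n)
    (x : EuclideanSpace ℝ (Fin n)) :
    (fderiv ℝ (osc ψ h μ 0) x (EuclideanSpace.single k 1)) ^ 2 +
      (fderiv ℝ (osc ψ h μ (Real.pi / 2)) x (EuclideanSpace.single k 1)) ^ 2 =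
      (μ⁻¹) ^ 2 * (fderiv ℝ ψ x (EuclideanSpace.single k 1)) ^ 2 +
        (if h = k then ψ x else 0) ^ 2 := by
  rw [fderiv_osc h μ _ hψ hμ, fderiv_osc h μ _ hψ hμ, Real.sin_add_pi_div_two,
    Real.cos_add_pi_div_two, add_zero]
  linear_combination ((μ⁻¹) ^ 2 * (fderiv ℝ ψ x (EuclideanSpace.single k 1)) ^ 2 +
        (if h = k then ψ x else 0) ^ 2) * Real.sin_sq_add_cos_sq (μ * x h)

end oscillation

/-- The sequences a and b need not converge; boundedness and the common limit of c and d suffice. -/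
theorem tendsto_sq_mul_add_sq_mul {a b c d : ℕ → ℝ} {s l B : ℝ} (ha : ∀ j, |a j| ≤ B)
    (hb : ∀ j, |b j| ≤ B) (hs : Tendsto (fun j => a j ^ 2 + b j ^ 2) atTop (𝓝 s))
    (hc : Tendsto c atTop (𝓝 l)) (hd : Tendsto d atTop (𝓝 l)) :
    Tendsto (fun j => a j ^ 2 * c j + b j ^ 2 * d j) atTop (𝓝 (s * l)) := by
  have hsmall : ∀ {e f : ℕ → ℝ}, (∀ j, |e j| ≤ B) → Tendsto f atTop (𝓝 l) →
      Tendsto (fun j => e j ^ 2 * (f j - l)) atTop (𝓝 0) := by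
    intro e f he hf
    have h0 : Tendsto (fun j => f j - l) atTop (𝓝 0) := by
      simpa using hf.sub_const l
    refine bdd_le_mul_tendsto_zero' (B ^ 2) (Eventually.of_forall fun j => ?_) h0
    rw [abs_pow]
    exact pow_le_pow_left₀ (abs_nonneg _) (he j) 2
  have := ((hs.mul_const l).add (hsmall ha hc)).add (hsmall hb hd)
  rw [add_zero, add_zero] at this
  refine this.congr fun j => ?_
  ring

theorem continuousAt_fderiv_phiMap {m : ℕ} {φ : ℝ → ℝ} (hφ : AdmissiblePhi φ)
    {z : EuclideanSpace ℂ (Fin m)} (hz : z ≠ 0) : ContinuousAt (fderiv ℝ (phiMap φ)) z :=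
  ((contDiffAt_phiMap hφ hz).fderiv_right (m := 0) (by norm_num)).continuousAt

section oscillation

variable {n m : ℕ} {Ω : Set (EuclideanSpace ℝ (Fin n))} {φ : ℝ → ℝ}
  {𝒜 : Fin n → EuclideanSpace ℝ (Fin n) → Matrix (Fin m) (Fin m) ℂ}
  {ψ : EuclideanSpace ℝ (Fin n) → ℝ}

theorem exists_abs_fderiv_osc_le (hψ : ContDiff ℝ 1 ψ) (hψc : HasCompactSupport ψ) :
    ∃ B : ℝ, 0 ≤ B ∧ (∀ x, |ψ x| ≤ B) ∧ ∀ (h k : Fin n) (μ θ : ℝ) (x), 1 ≤ μ →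
      |fderiv ℝ (osc ψ h μ θ) x (EuclideanSpace.single k 1)| ≤ B := by
  obtain ⟨B₁, hB₁⟩ := hψ.continuous.bounded_above_of_compact_support hψc
  obtain ⟨B₂, hB₂⟩ := (hψ.continuous_fderiv one_ne_zero).bounded_above_of_compact_support
    (hψc.fderiv (𝕜 := ℝ))
  have h1 : 0 ≤ B₁ := (norm_nonneg _).trans (hB₁ 0)
  have h2 : 0 ≤ B₂ := (norm_nonneg _).trans (hB₂ 0)
  refine ⟨B₁ + B₂, by positivity, fun x => (hB₁ x).trans (by linarith), ?_⟩
  intro h k μ θ x hμ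
  have hμ0 : 0 < μ := by linarith
  rw [fderiv_osc h μ θ hψ hμ0.ne']
  have e1 : |μ⁻¹ * fderiv ℝ ψ x (EuclideanSpace.single k 1) * Real.sin (μ * x h + θ)| ≤ B₂ := by
    have e : |fderiv ℝ ψ x (EuclideanSpace.single k 1)| ≤ B₂ := by
      have := (fderiv ℝ ψ x).le_opNorm (EuclideanSpace.single k (1 : ℝ))
      rw [PiLp.norm_single, norm_one, mul_one] at this
      exact this.trans (hB₂ x)
    rw [abs_mul, abs_mul, abs_of_pos (inv_pos.2 hμ0)]
    calc μ⁻¹ * |fderiv ℝ ψ x (EuclideanSpace.single k 1)| * |Real.sin (μ * x h + θ)|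
        ≤ 1 * B₂ * 1 := by
          gcongr
          · exact inv_le_one_of_one_le₀ hμ
          · exact Real.abs_sin_le_one _
      _ = B₂ := by ring
  have e2 : |(if h = k then ψ x else 0) * Real.cos (μ * x h + θ)| ≤ B₁ := by
    have e : |if h = k then ψ x else 0| ≤ B₁ := by
      split_ifs
      · exact hB₁ x
      · simpa using h1
    rw [abs_mul]
    calc _ ≤ B₁ * 1 := by
          gcongr
          exact Real.abs_cos_le_one _
      _ = B₁ := mul_one _
  exact (abs_add_le _ _).trans (by linarith)

/-- Dissipativity is applied to u + ση for both phases and the results are added, whence the factor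
2. As μ → ∞ the profile σ tends to 0, while the squares of its h-th derivative sum to ψ² in the
limit and those of the others to 0. -/
theorem nonneg_base_add_integral (hφ : AdmissiblePhi φ) (hΩ : IsOpen Ω)
    (h𝒜 : ∀ h i j, LocallyIntegrableOn (fun x => 𝒜 h x i j) Ω volume)
    (hdiss : ∀ u, IsC1Compact Ω u → IsC1Compact Ω (fun x => phiMap φ (u x)) →
      0 ≤ ∫ x in Ω, energy φ 𝒜 u x)
    (hψ : ContDiff ℝ 1 ψ) (hψc : HasCompactSupport ψ) (hψΩ : tsupport ψ ⊆ Ω)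
    {z : EuclideanSpace ℂ (Fin m)} (hz : z ≠ 0)
    {u : EuclideanSpace ℝ (Fin n) → EuclideanSpace ℂ (Fin m)} (hu : IsC1Compact Ω u)
    (hg : IsC1Compact Ω fun x => phiMap φ (u x)) (huz : ∀ᶠ x in 𝓝ˢ (tsupport ψ), u x = z)
    (η : EuclideanSpace ℂ (Fin m)) (h : Fin n) :
    0 ≤ 2 * (∫ x in Ω, energy φ 𝒜 u x) +
      ∫ x in Ω, ψ x ^ 2 * reForm (𝒜 h x) η (fderiv ℝ (phiMap φ) z η) := by
  have hK : IsCompact (tsupport ψ) := hψc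
  have huz' : ∀ x ∈ tsupport ψ, u x = z := fun x hx => huz.self_of_nhdsSet x hx
  have hz0 := norm_pos_iff.2 hz
  obtain ⟨B, hB0, hBψ, hB⟩ := exists_abs_fderiv_osc_le hψ hψc
  have hball : ∀ y ∈ Metric.closedBall z (‖z‖ / 2), y ≠ 0 := by
    rintro y hy rfl
    rw [mem_closedBall_iff_norm, zero_sub, norm_neg] at hy
    linarith
  obtain ⟨D, hD⟩ := (isCompact_closedBall z (‖z‖ / 2)).exists_bound_of_continuousOn
    (f := fderiv ℝ (phiMap φ)) fun y hy =>
      (continuousAt_fderiv_phiMap hφ (hball y hy)).continuousWithinAt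
  have hD0 : 0 ≤ D := (norm_nonneg _).trans (hD z (Metric.mem_closedBall_self (by positivity)))
  -- Frequencies above J keep |ση| ≤ |z|/2, so the perturbed values stay in a closed ball around z
  -- that misses 0; the extra 1 in μ ensures μ ≥ 1.
  obtain ⟨J, hJ⟩ := exists_nat_gt (2 * B * ‖η‖ / ‖z‖)
  set μ : ℕ → ℝ := fun j => (j : ℝ) + J + 1 with hμdef
  have hμ1 : ∀ j, 1 ≤ μ j := fun j => by
    have : (0 : ℝ) ≤ (j : ℝ) + J := by positivity
    simp only [hμdef]; linarith
  have hμ0 : ∀ j, 0 < μ j := fun j => one_pos.trans_le (hμ1 j)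
  have hμlim : Tendsto (fun j => (μ j)⁻¹) atTop (𝓝 0) := by
    refine tendsto_inv_atTop_zero.comp ?_
    exact tendsto_atTop_add_const_right _ _
      (tendsto_atTop_add_const_right _ _ tendsto_natCast_atTop_atTop)
  have hσlim : ∀ θ x, Tendsto (fun j => osc ψ h (μ j) θ x) atTop (𝓝 0) := by
    intro θ x
    refine squeeze_zero_norm (fun j => abs_osc_le h (μ j) θ hBψ (hμ0 j) x) ?_
    simpa using hμlim.mul_const B
  have hmem : ∀ j θ x, z + osc ψ h (μ j) θ x • η ∈ Metric.closedBall z (‖z‖ / 2) := by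
    intro j θ x
    rw [mem_closedBall_iff_norm, add_sub_cancel_left, norm_smul, Real.norm_eq_abs]
    calc |osc ψ h (μ j) θ x| * ‖η‖ ≤ (μ j)⁻¹ * B * ‖η‖ := by
          gcongr
          exact abs_osc_le h (μ j) θ hBψ (hμ0 j) x
      _ ≤ ‖z‖ / 2 := by
          rw [mul_assoc, inv_mul_le_iff₀ (hμ0 j)]
          rw [div_lt_iff₀ hz0] at hJ
          have : (J : ℝ) * ‖z‖ ≤ μ j * ‖z‖ := by
            gcongr
            simp only [hμdef]
            have : (0 : ℝ) ≤ j := by positivity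
            linarith
          linarith
  set T : ℝ → ℕ → EuclideanSpace ℝ (Fin n) → ℝ := fun θ j x =>
    ∑ k, (fderiv ℝ (osc ψ h (μ j) θ) x (EuclideanSpace.single k 1)) ^ 2 *
      reForm (𝒜 k x) η (fderiv ℝ (phiMap φ) (z + osc ψ h (μ j) θ x • η) η) with hT
  have hTen : ∀ θ j, IntegrableOn (T θ j) Ω ∧
      0 ≤ (∫ x in Ω, energy φ 𝒜 u x) + ∫ x in Ω, T θ j x := by
    intro θ j
    have c1 := contDiff_osc h (μ j) θ hψ
    have c2 : tsupport (osc ψ h (μ j) θ) ⊆ tsupport ψ := tsupport_osc_subset h (μ j) θ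
    have c3 : ∀ x, z + osc ψ h (μ j) θ x • η ≠ 0 := fun x => hball _ (hmem j θ x)
    have c4 := isC1Compact_add_smul (η := η) hK hψΩ hu c1 c2
    have c5 := isC1Compact_phiMap_add_smul hφ hK hψΩ hu hg huz' c1 c2 c3
    have c6 := integrableOn_energy hΩ h𝒜 hu hg
    have c7 := integrableOn_energy hΩ h𝒜 c4 c5
    have heq := energy_add_smul (𝒜 := 𝒜) hφ huz c1 c2 c3
    have heq' : T θ j = fun x => energy φ 𝒜 (fun y => u y + osc ψ h (μ j) θ y • η) x
        - energy φ 𝒜 u x := by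
      funext x
      rw [heq x]
      simp [hT]
    have c8 : IntegrableOn (T θ j) Ω := by
      rw [heq']
      exact c7.sub c6
    refine ⟨c8, ?_⟩
    rw [← integral_add c6 c8]
    have := hdiss _ c4 c5
    simpa only [heq] using this
  -- Dominating function independent of θ and j: B bounds the derivatives of the profiles and D the
  -- differential of `phiMap φ` on the ball.
  set bound : EuclideanSpace ℝ (Fin n) → ℝ := (tsupport ψ).indicator fun x =>
    ∑ k, B ^ 2 * ((∑ i, ∑ j, ‖𝒜 k x i j‖) * (‖η‖ * (D * ‖η‖))) with hbound
  have hTb : ∀ θ j x, |T θ j x| ≤ bound x := by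
    intro θ j x
    by_cases hx : x ∈ tsupport ψ
    · rw [hbound, indicator_of_mem hx]
      refine (Finset.abs_sum_le_sum_abs _ _).trans (Finset.sum_le_sum fun k _ => ?_)
      rw [abs_mul, abs_pow]
      gcongr
      · exact hB h k _ θ x (hμ1 j)
      · refine (abs_reForm_le _ _ _).trans ?_
        gcongr
        exact ((fderiv ℝ (phiMap φ) _).le_opNorm η).trans
          (mul_le_mul_of_nonneg_right (hD _ (hmem j θ x)) (norm_nonneg _))
    · rw [hbound, indicator_of_notMem hx, hT]
      have : fderiv ℝ (osc ψ h (μ j) θ) x = 0 :=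
        fderiv_of_notMem_tsupport (𝕜 := ℝ) fun hx' => hx (tsupport_osc_subset h (μ j) θ hx')
      simp [this]
  have hbi : Integrable bound (volume.restrict Ω) := by
    rw [hbound, integrable_indicator_iff (isClosed_tsupport ψ).measurableSet]
    refine IntegrableOn.restrict ?_
    refine integrable_finsetSum _ fun k _ => Integrable.const_mul (Integrable.mul_const
      (integrable_finsetSum _ fun i _ => integrable_finsetSum _ fun j _ => ?_) _) _
    exact ((h𝒜 k i j).integrableOn_compact_subset hψΩ hK).norm
  have hlim : Tendsto (fun j => ∫ x in Ω, (T 0 j x + T (Real.pi / 2) j x)) atTop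
      (𝓝 (∫ x in Ω, ψ x ^ 2 * reForm (𝒜 h x) η (fderiv ℝ (phiMap φ) z η))) := by
    refine tendsto_integral_of_dominated_convergence (fun x => bound x + bound x)
      (fun j => ((hTen _ j).1.add (hTen _ j).1).aestronglyMeasurable) (hbi.add hbi)
      (fun j => Eventually.of_forall fun x =>
        (abs_add_le _ _).trans (add_le_add (hTb _ _ _) (hTb _ _ _)))
      (Eventually.of_forall fun x => ?_)
    have hc : ∀ k θ, Tendsto (fun j => reForm (𝒜 k x) η
        (fderiv ℝ (phiMap φ) (z + osc ψ h (μ j) θ x • η) η)) atTop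
        (𝓝 (reForm (𝒜 k x) η (fderiv ℝ (phiMap φ) z η))) := by
      intro k θ
      have h1 : Tendsto (fun j => z + osc ψ h (μ j) θ x • η) atTop (𝓝 z) := by
        simpa using ((hσlim θ x).smul_const η).const_add z
      have h2 := (continuousAt_fderiv_phiMap hφ hz).tendsto.comp h1
      have h3 : Continuous fun A : EuclideanSpace ℂ (Fin m) →L[ℝ] EuclideanSpace ℂ (Fin m) =>
          reForm (𝒜 k x) η (A η) :=
        continuous_reForm _ continuous_const (by fun_prop)
      exact (h3.tendsto _).comp h2
    have hsum := tendsto_finsetSum (Finset.univ : Finset (Fin n)) fun k _ =>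
      tendsto_sq_mul_add_sq_mul (fun j => hB h k (μ j) 0 x (hμ1 j))
        (fun j => hB h k (μ j) (Real.pi / 2) x (hμ1 j))
        (s := (if h = k then ψ x else 0) ^ 2) (by
          simp only [fun j => sq_fderiv_osc_add h (μ j) hψ (hμ0 j).ne' k x]
          have h4 := ((hμlim.pow 2).mul_const
            ((fderiv ℝ ψ x (EuclideanSpace.single k 1)) ^ 2)).add_const
              ((if h = k then ψ x else 0) ^ 2)
          rwa [zero_pow two_ne_zero, zero_mul, zero_add] at h4) (hc k 0) (hc k (Real.pi / 2))
    have hval : ∑ k, (if h = k then ψ x else 0) ^ 2 *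
        reForm (𝒜 k x) η (fderiv ℝ (phiMap φ) z η) =
        ψ x ^ 2 * reForm (𝒜 h x) η (fderiv ℝ (phiMap φ) z η) := by
      rw [Finset.sum_eq_single h]
      · simp
      · intro k _ hk
        simp [hk.symm]
      · simp
    rw [← hval]
    simpa only [hT, Finset.sum_add_distrib] using hsum
  have hge : ∀ j, -(2 * ∫ x in Ω, energy φ 𝒜 u x) ≤
      ∫ x in Ω, (T 0 j x + T (Real.pi / 2) j x) := by
    intro j
    rw [integral_add (hTen _ j).1 (hTen _ j).1]
    have e1 := (hTen 0 j).2
    have e2 := (hTen (Real.pi / 2) j).2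
    linarith
  have := ge_of_tendsto hlim (Eventually.of_forall hge)
  linarith

theorem integral_sq_mul_nonneg (hφ : AdmissiblePhi φ) (hΩ : IsOpen Ω)
    (h𝒜 : ∀ h i j, LocallyIntegrableOn (fun x => 𝒜 h x i j) Ω volume)
    (hdiss : ∀ u, IsC1Compact Ω u → IsC1Compact Ω (fun x => phiMap φ (u x)) →
      0 ≤ ∫ x in Ω, energy φ 𝒜 u x)
    (hψ : ContDiff ℝ 1 ψ) (hψc : HasCompactSupport ψ) (hψΩ : tsupport ψ ⊆ Ω)
    {z : EuclideanSpace ℂ (Fin m)} (hz : z ≠ 0) (η : EuclideanSpace ℂ (Fin m)) (h : Fin n) :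
    0 ≤ ∫ x in Ω, ψ x ^ 2 * reForm (𝒜 h x) η (fderiv ℝ (phiMap φ) z η) := by
  obtain ⟨u, hu, hg, huz⟩ := exists_base hφ hΩ hψc.isCompact hψΩ hz
  set Q := ∫ x in Ω, ψ x ^ 2 * reForm (𝒜 h x) η (fderiv ℝ (phiMap φ) z η) with hQ
  set E := ∫ x in Ω, energy φ 𝒜 u x with hE
  -- The base field does not depend on η, so replacing η by tη multiplies Q by t² and leaves E
  -- unchanged.
  have hall : ∀ t : ℝ, 0 ≤ 2 * E + t ^ 2 * Q := by
    intro t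
    have := nonneg_base_add_integral hφ hΩ h𝒜 hdiss hψ hψc hψΩ hz hu hg huz (t • η) h
    have heq : ∀ x, ψ x ^ 2 * reForm (𝒜 h x) (t • η) (fderiv ℝ (phiMap φ) z (t • η)) =
        t ^ 2 * (ψ x ^ 2 * reForm (𝒜 h x) η (fderiv ℝ (phiMap φ) z η)) := by
      intro x
      rw [map_smul, reForm_smul_left, reForm_smul_right]
      ring
    simpa only [heq, integral_const_mul] using this
  by_contra! hneg
  -- If Q < 0, this t gives t²Q = -(2|E| + 1), and then 2E + t²Q ≤ -1.
  have := hall (√((2 * |E| + 1) / -Q))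
  rw [Real.sq_sqrt (div_nonneg (by positivity) (by linarith)), div_neg, neg_mul,
    div_mul_cancel₀ _ hneg.ne] at this
  linarith [le_abs_self E, abs_nonneg E]

end oscillation

/-! ### From integral inequalities to almost every point. -/

/-- A function, locally integrable in an open set, whose integral against squares of test functions
is non-negative is non-negative almost everywhere. -/
theorem ae_nonneg_of_integral_sq_mul_nonneg {n : ℕ} {Ω : Set (EuclideanSpace ℝ (Fin n))}
    (hΩ : IsOpen Ω) {q : EuclideanSpace ℝ (Fin n) → ℝ} (hq : LocallyIntegrableOn q Ω volume)
    (h : ∀ ψ : EuclideanSpace ℝ (Fin n) → ℝ, ContDiff ℝ 1 ψ → HasCompactSupport ψ →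
      tsupport ψ ⊆ Ω → 0 ≤ ∫ x in Ω, ψ x ^ 2 * q x) :
    ∀ᵐ x ∂(volume.restrict Ω), 0 ≤ q x := by
  -- Squares of cutoffs supported in shrinking thickenings of K converge to the indicator of K.
  have hcomp : ∀ K : Set (EuclideanSpace ℝ (Fin n)), IsCompact K → K ⊆ Ω →
      0 ≤ ∫ x in K, q x := by
    intro K hK hKΩ
    obtain ⟨δ, hδ0, hδ⟩ := hK.exists_cthickening_subset_open hΩ hKΩ
    set C := Metric.cthickening δ K with hC
    have hCc : IsCompact C := hK.cthickening
    obtain ⟨r, -, hr, hrlim⟩ := exists_seq_strictAnti_tendsto' hδ0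
    have hψ : ∀ j, ∃ ψ : EuclideanSpace ℝ (Fin n) → ℝ, ContDiff ℝ 1 ψ ∧
        (∀ x, ψ x ∈ Icc (0 : ℝ) 1) ∧ Function.support ψ = Metric.thickening (r j) K ∧
        ∀ x ∈ K, ψ x = 1 := by
      intro j
      obtain ⟨f, hf, hf1, hf2, hf3⟩ := exists_contMDiff_support_eq_eq_one_iff (n := 1)
        (modelWithCornersSelf ℝ (EuclideanSpace ℝ (Fin n)))
        (Metric.isOpen_thickening (δ := r j) (E := K)) hK.isClosed
        (Metric.self_subset_thickening (hr j).1 K)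
      exact ⟨f, hf.contDiff, fun x => hf1 (mem_range_self x), hf2, fun x hx => (hf3 x).1 hx⟩
    choose ψ hψc hψ01 hψs hψ1 using hψ
    have hsub : ∀ j, Function.support (ψ j) ⊆ C := fun j => by
      rw [hψs]
      exact Metric.thickening_subset_cthickening_of_le (hr j).2.le K
    have htsub : ∀ j, tsupport (ψ j) ⊆ C := fun j => closure_minimal (hsub j) hCc.isClosed
    have hqm : AEStronglyMeasurable q (volume.restrict Ω) := hq.aestronglyMeasurable
    have hlim : Tendsto (fun j => ∫ x in Ω, ψ j x ^ 2 * q x) atTop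
        (𝓝 (∫ x in Ω, K.indicator q x)) := by
      refine tendsto_integral_of_dominated_convergence (C.indicator fun x => ‖q x‖)
        (fun j => ((hψc j).continuous.pow 2).aestronglyMeasurable.mul hqm) ?_
        (fun j => Eventually.of_forall fun x => ?_) (Eventually.of_forall fun x => ?_)
      · rw [integrable_indicator_iff hCc.measurableSet]
        exact IntegrableOn.restrict (hq.integrableOn_compact_subset hδ hCc).norm
      · by_cases hx : x ∈ C
        · rw [indicator_of_mem hx, norm_mul, norm_pow, Real.norm_of_nonneg (hψ01 j x).1]
          exact mul_le_of_le_one_left (norm_nonneg _)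
            (pow_le_one₀ (hψ01 j x).1 (hψ01 j x).2)
        · have : ψ j x = 0 := Function.notMem_support.1 fun hs => hx (hsub j hs)
          simp [this, hx]
      · by_cases hx : x ∈ K
        · simp [hψ1 _ x hx, hx]
        · rw [indicator_of_notMem hx]
          refine tendsto_const_nhds.congr' ?_
          obtain ⟨ε, hε0, hε⟩ : ∃ ε, 0 < ε ∧ x ∉ Metric.thickening ε K := by
            rw [← hK.isClosed.closure_eq, Metric.closure_eq_iInter_thickening K] at hx
            simpa using hx
          filter_upwards [(tendsto_order.1 hrlim).2 ε hε0] with j hj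
          have : ψ j x = 0 := Function.notMem_support.1 fun hs => by
            rw [hψs] at hs
            exact hε (Metric.thickening_mono hj.le K hs)
          simp [this]
    have := ge_of_tendsto' hlim fun j => h (ψ j) (hψc j)
      (hCc.of_isClosed_subset (isClosed_tsupport _) (htsub j)) ((htsub j).trans hδ)
    rwa [integral_indicator hK.measurableSet, Measure.restrict_restrict hK.measurableSet,
      inter_eq_self_of_subset_left hKΩ] at this
  have hqm : AEStronglyMeasurable q (volume.restrict Ω) := hq.aestronglyMeasurable
  set q' := hqm.mk q with hq'
  have hqq' : q =ᵐ[volume.restrict Ω] q' := hqm.ae_eq_mk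
  suffices hnull : volume (Ω ∩ {x | q' x < 0}) = 0 by
    have h1 : ∀ᵐ x ∂(volume.restrict Ω), 0 ≤ q' x := by
      rw [ae_restrict_iff' hΩ.measurableSet, ae_iff]
      convert hnull using 2
      ext x
      simp
    filter_upwards [h1, hqq'] with x hx1 hx2
    rwa [hx2]
  have hS : MeasurableSet (Ω ∩ {x | q' x < 0}) :=
    hΩ.measurableSet.inter (measurableSet_lt hqm.stronglyMeasurable_mk.measurable
      measurable_const)
  by_contra hpos
  -- Inner regularity: a non-null set of negativity of the measurable representative contains a
  -- compact set of positive measure, where the integral is strictly negative.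
  obtain ⟨K, hKS, hK, hKpos⟩ := hS.exists_lt_isCompact (pos_iff_ne_zero.2 hpos)
  have hKΩ : K ⊆ Ω := hKS.trans inter_subset_left
  have h1 := hcomp K hK hKΩ
  have hqK : q =ᵐ[volume.restrict K] q' := ae_restrict_of_ae_restrict_of_subset hKΩ hqq'
  rw [integral_congr_ae hqK] at h1
  have hint : IntegrableOn q' K :=
    (hq.integrableOn_compact_subset hKΩ hK).congr hqK
  have h2 : 0 < ∫ x in K, -q' x := by
    rw [setIntegral_pos_iff_support_of_nonneg_ae]
    · refine hKpos.trans_le (measure_mono fun x hx => ⟨?_, hx⟩)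
      exact (neg_pos.2 (hKS hx).2).ne'
    · filter_upwards [ae_restrict_mem hK.measurableSet] with x hx
      exact (neg_pos.2 (hKS hx).2).le
    · exact hint.neg
  rw [integral_neg] at h2
  linarith

theorem locallyIntegrableOn_reForm {n m : ℕ} {Ω : Set (EuclideanSpace ℝ (Fin n))}
    (hΩ : IsOpen Ω) {A : EuclideanSpace ℝ (Fin n) → Matrix (Fin m) (Fin m) ℂ}
    (hA : ∀ i j, LocallyIntegrableOn (fun x => A x i j) Ω volume)
    (a b : EuclideanSpace ℂ (Fin m)) :
    LocallyIntegrableOn (fun x => reForm (A x) a b) Ω volume := by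
  rw [locallyIntegrableOn_iff hΩ.isLocallyClosed]
  intro K hKΩ hK
  simp only [reForm_eq_sum]
  refine Integrable.re (𝕜 := ℂ) (integrable_finsetSum _ fun i _ => integrable_finsetSum _
    fun j _ => Integrable.mul_const ?_ _)
  exact (hA i j).integrableOn_compact_subset hKΩ hK

/-- The exceptional null set in the hypothesis depends on (z, η). A countable dense set of pairs
gives a common one, and continuity of the form in (z, η) for z ≠ 0 extends the inequality to all
pairs. -/
theorem ae_algCond {n m : ℕ} {φ : ℝ → ℝ} (hφ : AdmissiblePhi φ)
    {Ω : Set (EuclideanSpace ℝ (Fin n))}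
    {A : EuclideanSpace ℝ (Fin n) → Matrix (Fin m) (Fin m) ℂ}
    (h : ∀ z η : EuclideanSpace ℂ (Fin m), z ≠ 0 → ∀ᵐ x ∂(volume.restrict Ω),
      0 ≤ reForm (A x) η (fderiv ℝ (phiMap φ) z η)) :
    ∀ᵐ x ∂(volume.restrict Ω), AlgCond (A x) (LambdaInfty φ) := by
  obtain ⟨S, hSc, hSd⟩ := TopologicalSpace.exists_countable_dense
    ({z : EuclideanSpace ℂ (Fin m) // z ≠ 0} × EuclideanSpace ℂ (Fin m))
  have hae : ∀ᵐ x ∂(volume.restrict Ω), ∀ p ∈ S,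
      0 ≤ reForm (A x) p.2 (fderiv ℝ (phiMap φ) p.1.1 p.2) :=
    (ae_ball_iff hSc).2 fun p _ => h p.1.1 p.2 p.1.2
  filter_upwards [hae] with x hx
  rw [algCond_LambdaInfty_iff hφ]
  intro z η hz
  have hG : Continuous fun y : {z : EuclideanSpace ℂ (Fin m) // z ≠ 0} =>
      fderiv ℝ (phiMap φ) y.1 := by
    rw [continuous_iff_continuousAt]
    intro y
    exact ContinuousAt.comp (f := Subtype.val) (g := fderiv ℝ (phiMap φ))
      (continuousAt_fderiv_phiMap hφ y.2) continuous_subtype_val.continuousAt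
  have hcont : Continuous fun p : {z : EuclideanSpace ℂ (Fin m) // z ≠ 0} ×
      EuclideanSpace ℂ (Fin m) => reForm (A x) p.2 (fderiv ℝ (phiMap φ) p.1.1 p.2) :=
    continuous_reForm _ continuous_snd ((hG.comp continuous_fst).clm_apply continuous_snd)
  have hclosed : IsClosed {p : {z : EuclideanSpace ℂ (Fin m) // z ≠ 0} ×
      EuclideanSpace ℂ (Fin m) | 0 ≤ reForm (A x) p.2 (fderiv ℝ (phiMap φ) p.1.1 p.2)} :=
    isClosed_le continuous_const hcont
  have hmem := closure_minimal hx hclosed (hSd (⟨z, hz⟩, η))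
  exact hmem

theorem mainTheorem1 (n m : ℕ) (φ : ℝ → ℝ) (hφ : AdmissiblePhi φ)
    (Ω : Set (EuclideanSpace ℝ (Fin n))) (hΩ_open : IsOpen Ω) (hΩ_conn : IsConnected Ω)
    (𝒜 : Fin n → EuclideanSpace ℝ (Fin n) → Matrix (Fin m) (Fin m) ℂ)
    (h𝒜 : ∀ h i j, LocallyIntegrableOn (fun x => 𝒜 h x i j) Ω volume) :
    IsLPhiDissipative φ Ω (diagCoeff 𝒜) ↔
      ∀ h : Fin n, ∀ᵐ x ∂(volume.restrict Ω), ∀ l w : EuclideanSpace ℂ (Fin m), ‖w‖ = 1 →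
        0 ≤ (hermProd (matVec (𝒜 h x) l) l).re
          - LambdaInfty φ ^ 2 * (hermProd (matVec (𝒜 h x) w) w).re * (hermProd l w).re ^ 2
          + LambdaInfty φ
            * (hermProd (matVec (𝒜 h x) w) l - hermProd (matVec (𝒜 h x) l) w).re
            * (hermProd l w).re := by
  change _ ↔ ∀ h : Fin n, ∀ᵐ x ∂(volume.restrict Ω), AlgCond (𝒜 h x) (LambdaInfty φ)
  rw [isLPhiDissipative_iff hΩ_open h𝒜]
  constructor
  · intro hdiss h
    refine ae_algCond hφ fun z η hz => ?_
    exact ae_nonneg_of_integral_sq_mul_nonneg hΩ_open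
      (locallyIntegrableOn_reForm hΩ_open (h𝒜 h) _ _) fun ψ hψ hψc hψΩ =>
        integral_sq_mul_nonneg hφ hΩ_open h𝒜 hdiss hψ hψc hψΩ hz η h
  · intro hcond u hu hg
    refine integral_nonneg_of_ae ?_
    filter_upwards [ae_all_iff.2 hcond] with x hx
    exact Finset.sum_nonneg fun h _ => (hx h).reForm_partialDeriv_nonneg hφ
      (hu.contDiff.differentiable one_ne_zero x) (hg.contDiff.differentiable one_ne_zero x) h
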